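/- Let $G=(V,E)$ be a finite connected simple graph (so its girth is at least $3$) with $v=|V|$ vertices, and let $p_1(G)=|E|-v+1$ be its cyclomatic number. Fix a linear ordering of $E$ and let $\mathcal A_2=\mathbb Z[x]/(x^2)$. For $s\subseteq E$ let $[G:s]$ be the graph with vertex set $V$ and edge set $s$, and let $k(s)$ be the number of its connected components. The chromatic cochain complex of $G$ over $\mathcal A_2$ has $C^i(G)=\bigoplus_{|s|=i}\mathcal A_2^{\otimes k(s)}$, with one tensor factor for each component of $[G:s]$, and differential $d=\sum_{e\notin s}(-1)^{t(s,e)}d_e$ on the summand of $s$, where $t(s,e)$ is the number of edges in $s$ that precede $e$. If $e$ joins two different components of $[G:s]$, then $d_e\colon\mathcal A_2^{\otimes k(s)}\to\mathcal A_2^{\otimes k(s\cup e)}$ multiplies the two corresponding tensor factors; otherwise $d_e$ is the identity. Each $C^i(G)$ has as a basis the enhanced states: sets $s$ of $i$ edges with every component of $[G:s]$ labelled by $1$ or $x$. Let $C^{i,j}(G)$ be the span of those with exactly $j$ components labelled $x$; $d$ preserves $j$. Let $C_{i,j}(G)$ be the dual chain complex, that is, the free abelian group on the enhanced states of bidegree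 $(i,j)$, with boundary map $\partial\colon C_{i,j}(G)\to C_{i-1,j}(G)$ the transpose of $d$, and let $H_{i,j}(G)=\ker\partial/\operatorname{im}\partial$ in bidegree $(i,j)$ be the chromatic graph homology of $G$ over $\mathcal A_2$. Then: (i) if $G$ is bipartite, $H_{1,v-2}(G)\cong\mathbb Z_2^{\,p_1(G)}$; (ii) if $G$ has an odd cycle, then $p_1(G)\ge 1$ and $H_{1,v-2}(G)\cong\mathbb Z_2^{\,p_1(G)-1}\oplus\mathbb Z$. (For $v=1$ one has $C_{i,-1}(G)=0$.) -/

import Mathlib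

namespace ChromaticHomology

/-- The two basis elements `1` and `x` of the algebra `ℤ[x]/(x²)`. -/
inductive Label
  | one
  | x
  deriving DecidableEq

/-- The algebra `A₂ = ℤ[x]/(x²)`: Mathlib's dual numbers over `ℤ`, with `x = DualNumber.eps`. -/
abbrev A₂ : Type := DualNumber ℤ

/-- A label as an element of `A₂`. -/
def Label.toA₂ : Label → A₂
  | .one => 1
  | .x => DualNumber.eps

/-- The coefficient of an element of `A₂` at a basis element. -/
def Label.coeff : Label → A₂ → ℤ
  | .one, a => TrivSqZeroExt.fst a
  | .x, a => TrivSqZeroExt.snd a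

variable {V : Type*} {G : SimpleGraph V}

/-- The spanning subgraph `[G : s]`: all vertices of `G`, and the edges in `s`. -/
def spanning (s : Finset G.edgeSet) : SimpleGraph V :=
  SimpleGraph.fromEdgeSet {e | ∃ h : e ∈ G.edgeSet, (⟨e, h⟩ : G.edgeSet) ∈ s}

/-- The connected components of `[G : s]`. -/
abbrev Component (s : Finset G.edgeSet) : Type _ := (spanning s).ConnectedComponent

noncomputable instance [Finite V] (s : Finset G.edgeSet) : Fintype (Component s) :=
  Fintype.ofFinite _

/-- Enhanced states of bidegree `(i, j)`: a set of `i` edges, together with a labelling of the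
components of `[G : s]` by `1` and `x` in which exactly `j` components are labelled `x`. -/
@[ext]
structure EnhancedState [Finite V] (G : SimpleGraph V) (i : ℕ) (j : ℤ) where
  edges : Finset G.edgeSet
  label : Component edges → Label
  card_edges : edges.card = i
  card_x : ((Finset.univ.filter fun c => label c = Label.x).card : ℤ) = j

instance [Finite V] (i : ℕ) (j : ℤ) : Finite (EnhancedState G i j) := by
  have : Finite Label :=
    Finite.of_injective (fun l : Label => decide (l = Label.x)) (by
      intro a b h; cases a <;> cases b <;> simp_all)
  refine Finite.of_injective
    (β := (s : Finset G.edgeSet) × (Component s → Label)) (fun S => ⟨S.edges, S.label⟩) ?_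
  rintro ⟨s, a, _, _⟩ ⟨t, b, _, _⟩ h
  simp only [Sigma.mk.injEq] at h
  obtain ⟨rfl, h⟩ := h
  cases h
  rfl

noncomputable instance [Finite V] (i : ℕ) (j : ℤ) : Fintype (EnhancedState G i j) :=
  Fintype.ofFinite _

open Classical in
/-- Let `s ⊆ t` be sets of edges. Multiplying together the tensor factors of `A₂^{⊗ k(s)}` whose
components lie in the same component of `[G : t]` is a map `A₂^{⊗ k(s)} → A₂^{⊗ k(t)}`. This is its
matrix entry at the basis tensors given by the labellings `a` and `b`. For `t = s ∪ {e}`, where `e`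
joins two components of `[G : s]`, the map multiplies the two corresponding factors; where `e`
has both ends in one component, it is the identity. -/
noncomputable def mulCoeff [Finite V] {s t : Finset G.edgeSet}
    (a : Component s → Label) (b : Component t → Label) : ℤ :=
  ∏ c' : Component t, (b c').coeff
    (∏ c ∈ Finset.univ.filter (fun c : Component s => c.supp ⊆ c'.supp), (a c).toA₂)

open Classical in
/-- The sign `(-1)^{t(s,e)}`, where `t(s,e)` is the number of edges in `s` less than `e` in the given ordering of
the edges. -/
noncomputable def edgeSign (ord : LinearOrder G.edgeSet) (s : Finset G.edgeSet) (e : G.edgeSet) : ℤ :=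
  (-1) ^ (s.filter fun f => ord.lt f e).card

open Classical in
/-- The coefficient of the enhanced state `T` in `d S = ∑_{e ∉ s} (-1)^{t(s,e)} d_e S`, where `d` is
the differential of the chromatic cochain complex; at most one edge `e` contributes. -/
noncomputable def incidence [Finite V] (G : SimpleGraph V) (ord : LinearOrder G.edgeSet) (i : ℕ) (j : ℤ) :
    Matrix (EnhancedState G i j) (EnhancedState G (i + 1) j) ℤ :=
  fun S T => ∑ e ∈ T.edges \ S.edges,
    if insert e S.edges = T.edges then edgeSign ord S.edges e * mulCoeff S.label T.label else 0

/-- The chain group `C_{i,j}(G)`: the free abelian group on the (finitely many) enhanced states of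
bidegree `(i, j)`. The cochain group `C^{i,j}(G)` is its dual, with the dual basis. -/
abbrev ChainGroup [Finite V] (G : SimpleGraph V) (i : ℕ) (j : ℤ) : Type _ :=
  EnhancedState G i j → ℤ

/-- The chromatic cochain differential `d : C^{i,j}(G) → C^{i+1,j}(G)`. -/
noncomputable def coboundary [Finite V] (G : SimpleGraph V) (ord : LinearOrder G.edgeSet)
    (i : ℕ) (j : ℤ) : (EnhancedState G i j → ℤ) →ₗ[ℤ] (EnhancedState G (i + 1) j → ℤ) :=
  (incidence G ord i j).transpose.mulVecLin

/-- The boundary map `∂ : C_{i+1,j}(G) → C_{i,j}(G)`, the transpose of the chromatic cochain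
differential: `∂ T = ∑_S (incidence S T) S`. -/
noncomputable def boundary [Finite V] (G : SimpleGraph V) (ord : LinearOrder G.edgeSet)
    (i : ℕ) (j : ℤ) : ChainGroup G (i + 1) j →ₗ[ℤ] ChainGroup G i j :=
  (incidence G ord i j).mulVecLin

theorem spanning_mono {s t : Finset G.edgeSet} (h : s ⊆ t) : spanning s ≤ spanning t :=
  SimpleGraph.fromEdgeSet_mono fun _ ⟨he, hs⟩ => ⟨he, h hs⟩

theorem supp_subset_iff {s t : Finset G.edgeSet} (h : s ⊆ t) (c : Component s) (c' : Component t) :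
    c.supp ⊆ c'.supp ↔ c.map (SimpleGraph.Hom.ofLE (spanning_mono h)) = c' := by
  induction c using SimpleGraph.ConnectedComponent.ind with | _ v =>
  constructor
  · intro hs
    exact hs (show v ∈ SimpleGraph.ConnectedComponent.supp _ from rfl)
  · rintro rfl w hw
    have hw' : (spanning s).Reachable w v := SimpleGraph.ConnectedComponent.exact hw
    exact SimpleGraph.ConnectedComponent.sound (hw'.mono (spanning_mono h))

theorem Label.prod_toA₂ {ι : Type*} (F : Finset ι) (a : ι → Label) :
    ∏ c ∈ F, (a c).toA₂ = DualNumber.eps ^ (F.filter fun c => a c = Label.x).card := by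
  rw [Finset.card_filter, ← Finset.prod_pow_eq_pow_sum]
  refine Finset.prod_congr rfl fun c _ => ?_
  cases a c <;> simp [Label.toA₂]

theorem Label.coeff_eps_pow (l : Label) (n : ℕ) :
    l.coeff (DualNumber.eps ^ n) = if n = (if l = Label.x then 1 else 0) then 1 else 0 := by
  rcases n with _ | _ | n
  · cases l <;> simp [Label.coeff]
  · cases l <;> simp [Label.coeff]
  · have : (DualNumber.eps : A₂) ^ (n + 2) = 0 := by
      rw [pow_add, pow_two, DualNumber.eps_mul_eps, mul_zero]
    rw [this]
    cases l <;> simp [Label.coeff]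

open Classical in
theorem mulCoeff_eq [Finite V] {s t : Finset G.edgeSet} (h : s ⊆ t)
    (a : Component s → Label) (b : Component t → Label) :
    mulCoeff a b = if ∀ c' : Component t,
      (Finset.univ.filter fun c : Component s => a c = Label.x ∧
        c.map (SimpleGraph.Hom.ofLE (spanning_mono h)) = c').card
        = (if b c' = Label.x then 1 else 0) then 1 else 0 := by
  simp only [mulCoeff, Label.prod_toA₂, Label.coeff_eps_pow, supp_subset_iff h,
    Finset.filter_filter]
  rw [Finset.prod_ite_zero]
  simp [and_comm]

open Classical in
theorem sum_mulCoeff [Finite V] {s t u : Finset G.edgeSet} (hst : s ⊆ t) (htu : t ⊆ u)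
    {i : ℕ} {j : ℤ} (ht : t.card = i) (a : Component s → Label) (b : Component u → Label)
    (ha : ((Finset.univ.filter fun c => a c = Label.x).card : ℤ) = j) :
    ∑ T : EnhancedState G i j, (if T.edges = t then mulCoeff a T.label * mulCoeff T.label b else 0)
      = mulCoeff a b := by
  set φ : Component s → Component t := fun c => c.map (SimpleGraph.Hom.ofLE (spanning_mono hst))
    with hφ
  set ψ : Component t → Component u := fun c => c.map (SimpleGraph.Hom.ofLE (spanning_mono htu))
    with hψ
  have hcomp : ∀ c : Component s,
      c.map (SimpleGraph.Hom.ofLE (spanning_mono (hst.trans htu))) = ψ (φ c) := by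
    intro c
    induction c using SimpleGraph.ConnectedComponent.ind with | _ v => rfl
  set n : Component t → ℕ := fun c' =>
    (Finset.univ.filter fun c : Component s => a c = Label.x ∧ φ c = c').card with hn
  have hsum : ∀ c'' : Component u, (Finset.univ.filter fun c : Component s => a c = Label.x ∧
      ψ (φ c) = c'').card = ∑ c' ∈ Finset.univ.filter (fun c' => ψ c' = c''), n c' := by
    intro c''
    rw [Finset.card_eq_sum_card_fiberwise (f := φ)
      (t := Finset.univ.filter (fun c' => ψ c' = c''))]
    · refine Finset.sum_congr rfl fun c' hc' => ?_
      simp only [hn, Finset.filter_filter]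
      congr 1
      ext c
      simp only [Finset.mem_filter, Finset.mem_univ, true_and] at hc' ⊢
      constructor
      · rintro ⟨⟨h1, _⟩, h3⟩; exact ⟨h1, h3⟩
      · rintro ⟨h1, rfl⟩; exact ⟨⟨h1, hc'⟩, rfl⟩
    · intro c hc
      simp at hc ⊢
      exact hc.2
  have htot : (Finset.univ.filter fun c => a c = Label.x).card = ∑ c', n c' := by
    rw [Finset.card_eq_sum_card_fiberwise (f := φ) (t := Finset.univ) (by intro _ _; simp)]
    simp only [hn, Finset.filter_filter]
  rw [mulCoeff_eq (hst.trans htu)]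
  simp only [hcomp, hsum]
  by_cases hle : ∀ c', n c' ≤ 1
  · let b₀ : Component t → Label := fun c' => if n c' = 1 then Label.x else Label.one
    have hb₀ : ∀ c', n c' = if b₀ c' = Label.x then 1 else 0 := by
      intro c'
      have := hle c'
      simp only [b₀]
      by_cases h1 : n c' = 1
      · simp [h1]
      · simp [h1]; omega
    let T₀ : EnhancedState G i j := ⟨t, b₀, ht, by
      rw [← ha, htot, Finset.card_filter]
      simp only [← hb₀]⟩
    rw [Finset.sum_eq_single T₀]
    · rw [if_pos rfl]
      change mulCoeff a b₀ * mulCoeff b₀ b = _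
      rw [mulCoeff_eq hst, mulCoeff_eq htu, if_pos hb₀, one_mul]
      have : ∀ c'' : Component u, (Finset.univ.filter fun c : Component t => b₀ c = Label.x ∧
          c.map (SimpleGraph.Hom.ofLE (spanning_mono htu)) = c'').card =
          ∑ c' ∈ Finset.univ.filter (fun c' => ψ c' = c''), n c' := by
        intro c''
        simp only [hb₀]
        rw [← Finset.card_filter, Finset.filter_filter]
        simp only [hψ, and_comm]
      simp only [this]
    · rintro ⟨t', b', h1, h2⟩ - hne
      split_ifs with h
      · change t' = t at h
        subst h
        change mulCoeff a b' * mulCoeff b' b = 0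
        rw [mulCoeff_eq hst, if_neg, zero_mul]
        intro hall
        apply hne
        have : b' = b₀ := by
          funext c'
          have h3 := hall c'
          change n c' = _ at h3
          rw [hb₀ c'] at h3
          by_cases h4 : b' c' = Label.x
          · by_cases h5 : b₀ c' = Label.x
            · rw [h4, h5]
            · simp [h4, h5] at h3
          · by_cases h5 : b₀ c' = Label.x
            · simp [h4, h5] at h3
            · cases hb : b' c' <;> cases hb' : b₀ c' <;> simp_all
        subst this
        rfl
      · rfl
    · simp
  · push Not at hle
    obtain ⟨c', hc'⟩ := hle
    rw [if_neg]
    · refine Finset.sum_eq_zero ?_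
      rintro ⟨t', b', h1, h2⟩ -
      split_ifs with h
      · change t' = t at h
        subst h
        change mulCoeff a b' * mulCoeff b' b = 0
        rw [mulCoeff_eq hst, if_neg, zero_mul]
        intro hall
        have h3 := hall c'
        change n c' = _ at h3
        split_ifs at h3 <;> omega
      · rfl
    · intro hall
      have h3 := hall (ψ c')
      have h4 : n c' ≤ ∑ d ∈ Finset.univ.filter (fun d => ψ d = ψ c'), n d :=
        Finset.single_le_sum (f := n) (fun _ _ => Nat.zero_le _) (by simp)
      split_ifs at h3 <;> omega

open Classical in
theorem edgeSign_insert_add (ord : LinearOrder G.edgeSet) (s : Finset G.edgeSet) {e f : G.edgeSet}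
    (he : e ∉ s) (hf : f ∉ s) (hne : e ≠ f) :
    edgeSign ord s e * edgeSign ord (insert e s) f
      + edgeSign ord s f * edgeSign ord (insert f s) e = 0 := by
  have key : ∀ e f : G.edgeSet, e ∉ s → ord.lt e f →
      edgeSign ord s e * edgeSign ord (insert e s) f
        + edgeSign ord s f * edgeSign ord (insert f s) e = 0 := by
    intro e f he hlt
    have hnot : ¬ ord.lt f e := ((ord.lt_iff_le_not_ge e f).1 hlt).2 ∘ fun h =>
      ((ord.lt_iff_le_not_ge f e).1 h).1
    have h1 : edgeSign ord (insert e s) f = - edgeSign ord s f := by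
      unfold edgeSign
      rw [Finset.filter_insert, if_pos hlt, Finset.card_insert_of_notMem (by simp [he]), pow_succ]
      ring
    have h2 : edgeSign ord (insert f s) e = edgeSign ord s e := by
      unfold edgeSign
      rw [Finset.filter_insert, if_neg hnot]
    rw [h1, h2]; ring
  rcases ord.le_total e f with h | h
  · exact key e f he ((ord.lt_iff_le_not_ge e f).2 ⟨h, fun h' => hne (ord.le_antisymm _ _ h h')⟩)
  · rw [add_comm]
    exact key f e hf ((ord.lt_iff_le_not_ge f e).2 ⟨h, fun h' => hne (ord.le_antisymm _ _ h' h)⟩)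

open Classical in
theorem incidence_mul_incidence [Finite V] (ord : LinearOrder G.edgeSet) (i : ℕ) (j : ℤ) :
    incidence G ord i j * incidence G ord (i + 1) j = 0 := by
  ext S U
  rw [Matrix.mul_apply, Matrix.zero_apply]
  have h1 : ∀ T : EnhancedState G (i + 1) j, incidence G ord i j S T * incidence G ord (i + 1) j T U =
      ∑ p ∈ (U.edges \ S.edges).offDiag,
        if insert p.2 (insert p.1 S.edges) = U.edges then
          edgeSign ord S.edges p.1 * edgeSign ord (insert p.1 S.edges) p.2 *
          (if T.edges = insert p.1 S.edges then
            mulCoeff S.label T.label * mulCoeff T.label U.label else 0) else 0 := by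
    intro T
    by_cases hST : ∃ e ∉ S.edges, insert e S.edges = T.edges
    · obtain ⟨e, he, hT⟩ := hST
      by_cases hTU : ∃ f ∉ T.edges, insert f T.edges = U.edges
      · obtain ⟨f, hf, hU⟩ := hTU
        have e1 : T.edges \ S.edges = {e} := by
          rw [← hT]; ext g; simp only [Finset.mem_sdiff, Finset.mem_insert, Finset.mem_singleton]
          constructor
          · tauto
          · rintro rfl; tauto
        have e2 : U.edges \ T.edges = {f} := by
          rw [← hU]; ext g; simp only [Finset.mem_sdiff, Finset.mem_insert, Finset.mem_singleton]
          constructor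
          · tauto
          · rintro rfl; tauto
        have hef : e ≠ f := by
          rintro rfl; exact hf (hT ▸ Finset.mem_insert_self _ _)
        have hfS : f ∉ S.edges := fun h => hf (hT ▸ Finset.mem_insert_of_mem h)
        simp only [incidence]
        rw [e1, e2, Finset.sum_singleton, Finset.sum_singleton, if_pos hT, if_pos hU,
          Finset.sum_eq_single (e, f)]
        · rw [hT, if_pos hU, if_pos rfl]; ring
        · rintro ⟨e', f'⟩ hp hne
          split_ifs with h2 h3
          · exfalso
            simp only [Finset.mem_offDiag, Finset.mem_sdiff] at hp
            simp only at h2 h3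
            have : e' = e := by
              have : e' ∈ T.edges \ S.edges := by
                rw [h3]; simp [hp.1.2]
              rwa [e1, Finset.mem_singleton] at this
            subst this
            have : f' = f := by
              have : f' ∈ U.edges \ T.edges := by
                rw [Finset.mem_sdiff, h3, Finset.mem_insert]
                exact ⟨hp.2.1.1, by rintro (h | h); exacts [hp.2.2 h.symm, hp.2.1.2 h]⟩
              rwa [e2, Finset.mem_singleton] at this
            subst this
            exact hne rfl
          · simp
          · rfl
        · intro h
          exfalso; apply h
          rw [← hU, ← hT]
          simp [he, hfS, hef]
      · have : incidence G ord (i + 1) j T U = 0 := by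
          refine Finset.sum_eq_zero fun f hf => if_neg fun h => hTU ⟨f, ?_, h⟩
          exact (Finset.mem_sdiff.1 hf).2
        rw [this, mul_zero]
        symm
        refine Finset.sum_eq_zero ?_
        rintro ⟨e', f'⟩ hp
        split_ifs with h2 h3
        · exfalso
          simp only [Finset.mem_offDiag, Finset.mem_sdiff] at hp
          simp only at h2 h3
          refine hTU ⟨f', ?_, h3 ▸ h2⟩
          rw [h3, Finset.mem_insert]
          rintro (h | h)
          exacts [hp.2.2 h.symm, hp.2.1.2 h]
        · simp
        · rfl
    · have : incidence G ord i j S T = 0 := by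
        refine Finset.sum_eq_zero fun f hf => if_neg fun h => hST ⟨f, ?_, h⟩
        exact (Finset.mem_sdiff.1 hf).2
      rw [this, zero_mul]
      symm
      refine Finset.sum_eq_zero ?_
      rintro ⟨e', f'⟩ hp
      split_ifs with h2 h3
      · exfalso
        simp only [Finset.mem_offDiag, Finset.mem_sdiff] at hp
        exact hST ⟨e', hp.1.2, h3.symm⟩
      · simp
      · rfl
  rw [Finset.sum_congr rfl fun T _ => h1 T, Finset.sum_comm]
  have h2 : ∀ p ∈ (U.edges \ S.edges).offDiag,
      (∑ T : EnhancedState G (i + 1) j,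
        if insert p.2 (insert p.1 S.edges) = U.edges then
          edgeSign ord S.edges p.1 * edgeSign ord (insert p.1 S.edges) p.2 *
          (if T.edges = insert p.1 S.edges then
            mulCoeff S.label T.label * mulCoeff T.label U.label else 0) else 0) =
      if insert p.2 (insert p.1 S.edges) = U.edges then
          edgeSign ord S.edges p.1 * edgeSign ord (insert p.1 S.edges) p.2 *
            mulCoeff S.label U.label else 0 := by
    rintro ⟨e, f⟩ hp
    simp only [Finset.mem_offDiag, Finset.mem_sdiff] at hp
    split_ifs with h
    · rw [← Finset.mul_sum, sum_mulCoeff (Finset.subset_insert _ _)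
        (by simp only at h; rw [← h]; exact Finset.subset_insert _ _)
        (by rw [Finset.card_insert_of_notMem hp.1.2, S.card_edges]) _ _ S.card_x]
    · simp
  rw [Finset.sum_congr rfl h2]
  refine Finset.sum_involution (fun p _ => (p.2, p.1)) ?_ ?_ ?_ ?_
  · rintro ⟨e, f⟩ hp
    simp only [Finset.mem_offDiag, Finset.mem_sdiff] at hp
    simp only [Finset.insert_comm e f]
    split_ifs
    · rw [← add_mul, edgeSign_insert_add ord _ hp.1.2 hp.2.1.2 hp.2.2, zero_mul]
    · simp
  · rintro ⟨e, f⟩ hp - h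
    simp only [Finset.mem_offDiag] at hp
    exact hp.2.2 (Prod.ext_iff.1 h).2
  · rintro ⟨e, f⟩ hp
    simp only [Finset.mem_offDiag] at hp ⊢
    exact ⟨hp.2.1, hp.1, hp.2.2.symm⟩
  · rintro ⟨e, f⟩ _; rfl

/-- The chain groups and the boundary maps form a chain complex: `∂ ∘ ∂ = 0`. -/
theorem boundary_comp_boundary [Finite V] (ord : LinearOrder G.edgeSet) (i : ℕ) (j : ℤ) :
    boundary G ord i j ∘ₗ boundary G ord (i + 1) j = 0 := by
  rw [boundary, boundary, ← Matrix.mulVecLin_mul, incidence_mul_incidence, Matrix.mulVecLin_zero]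

/-- The cycles in `C_{i,j}(G)`; every 0-chain is a cycle. -/
noncomputable def cycles [Finite V] (G : SimpleGraph V) (ord : LinearOrder G.edgeSet) :
    (i : ℕ) → (j : ℤ) → Submodule ℤ (ChainGroup G i j)
  | 0, _ => ⊤
  | i + 1, j => LinearMap.ker (boundary G ord i j)

/-- The chromatic graph homology `H_{i,j}(G)` over `A₂`: cycles modulo boundaries. -/
abbrev Homology [Finite V] (G : SimpleGraph V) (ord : LinearOrder G.edgeSet) (i : ℕ) (j : ℤ) : Type _ :=
  cycles G ord i j ⧸ (LinearMap.range (boundary G ord i j)).submoduleOf (cycles G ord i j)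

/-- The cyclomatic number `p₁(G) = |E| - |V| + p₀(G)` of a finite graph, with `p₀(G)` the number of
connected components (`|V| ≤ |E| + p₀(G)` always, so the subtraction does not truncate). -/
noncomputable def cyclomaticNumber (G : SimpleGraph V) : ℕ :=
  Nat.card G.edgeSet + Nat.card G.ConnectedComponent - Nat.card V

end ChromaticHomology

/-!
Write `Φ` for the unsigned vertex-edge incidence matrix of `G`. A state in bidegree `(1, v - 2)` is
an edge `e` together with the one component of `[G : {e}]` that is labelled `1`; writing it `e ⊗ u`
for a vertex `u` of that component, the chain group becomes the group of edge-vertex matrices modulo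
the *null matrices*, spanned by the `e ⊗ (a - b)` with `e = ab`. States in bidegree `(0, v - 2)` are
pairs of vertices and states in bidegree `(2, v - 2)` are pairs of edges. In these terms
(`boundary_chainOf`, `boundary_eq_chainOf`)

* a matrix `Z` represents a cycle when `ΦZ + (ΦZ)ᵀ` is diagonal;
* the boundaries are represented by the matrices `BΦᵀ` with `B` skew-symmetric.

So the chain groups are a quotient of the part `Λ²ℤᴱ → ℤᴱ ⊗ ℤⱽ → Sym² ℤⱽ` of a Koszul complex of
`Φ`, and the homology is computed by linear algebra.

Let `K = ker Φ`, and let `r` be a vertex. Two invariants of a cycle `Z` vanish on null matrices and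
on boundaries: the projection to `K / 2K` of the vector of row sums of `Z`, and the trace of `ΦZ`.
They detect homology (`mem_sup_iff`). Indeed, if the trace vanishes, a null matrix can be subtracted
to make `ΦZ` skew-symmetric, because `G` is connected. Each vertex is `± r` modulo the columns of
`Φ`, which reads `1 = r χᵀ + ΦQ` as an equation of matrices, and this equation yields
`Z = g rᵀ + BΦᵀ` with `g ∈ K` and `B` skew-symmetric
(`exists_eq_vecMulVec_add_mul_transpose`). If moreover the first invariant vanishes, then `g = 2k`
with `k ∈ K`, and `2k rᵀ` is homologous to zero: given an odd cycle, `2r` is in the image of `Φ`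
(`two_smul_mem_of_eq_two`); in a bipartite graph, the same matrix identity is applied to the null
matrix `∑ kₑ χ(a) e ⊗ (a - b)` (`two_smul_mem_of_coloring`).

The matrices `k rᵀ` with `k ∈ K` realise all values in `K / 2K`. In a bipartite graph the trace is
always zero and `K` has rank `p₁`. With an odd cycle the trace is always even, it takes the value `2`
on `w rᵀ` with `Φw = 2r`, and `K` has rank `p₁ - 1`.
-/

namespace ChromaticHomology

open Matrix
open scoped Classical

/-! ### Skew-symmetric matrices and the Koszul relation -/

/-- Exactness of the Koszul complex of `Φ` up to multiples of `p`: if `Φ * Z` is skew-symmetric then,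
modulo the products `B * Φᵀ` with `B` skew-symmetric, `Z` is of rank one with a column in `ker Φ`. -/
theorem exists_eq_vecMulVec_add_mul_transpose {m n : Type*} [Fintype m] [Fintype n]
    (Φ : Matrix m n ℤ) (Q : Matrix n m ℤ) (p χ : m → ℤ) (hQ : vecMulVec p χ + Φ * Q = 1)
    (Z : Matrix n m ℤ) (hZ : (Φ * Z)ᵀ = -(Φ * Z)) :
    ∃ g : n → ℤ, ∃ B : Matrix n n ℤ, g = Z *ᵥ χ - Q *ᵥ (Φ *ᵥ (Z *ᵥ χ)) ∧ Φ *ᵥ g = 0 ∧ Bᵀ = -B ∧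
      Z = vecMulVec g p + B * Φᵀ := by
  set A := Φ * Z with hA
  set B := Z * Qᵀ - Q * Zᵀ - Q * A * Qᵀ with hB
  have hQT : vecMulVec χ p + Qᵀ * Φᵀ = 1 := by
    rw [← Matrix.transpose_mul, ← Matrix.transpose_vecMulVec, ← Matrix.transpose_add, hQ,
      Matrix.transpose_one]
  have hZΦ : Zᵀ * Φᵀ = -A := by rw [← Matrix.transpose_mul, hZ]
  -- Put `W = Z * Qᵀ`, so that `Z = (Z *ᵥ χ) pᵀ + W * Φᵀ`. Modulo skew-symmetric matrices `W` may be
  -- replaced by `Wᵀ`, and `Wᵀ * Φᵀ = Q * Aᵀ = -(Q * A)`, which is expanded by `hQ` once more.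
  refine ⟨_, B, rfl, ?_, ?_, ?_⟩
  · have h1 : A *ᵥ χ = p * (fun _ => χ ⬝ᵥ (A *ᵥ χ)) + Φ *ᵥ (Q *ᵥ (A *ᵥ χ)) := by
      conv_lhs => rw [← Matrix.one_mulVec (A *ᵥ χ), ← hQ, Matrix.add_mulVec, Matrix.vecMulVec_mulVec]
      rw [← Matrix.mulVec_mulVec _ Φ Q]
      rfl
    have h2 : χ ⬝ᵥ (A *ᵥ χ) = 0 := by
      have : χ ⬝ᵥ (A *ᵥ χ) = χ ⬝ᵥ (Aᵀ *ᵥ χ) := by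
        rw [Matrix.mulVec_transpose, Matrix.dotProduct_mulVec, dotProduct_comm]
      rw [hZ, Matrix.neg_mulVec, dotProduct_neg] at this
      omega
    rw [Matrix.mulVec_sub, Matrix.mulVec_mulVec _ Φ Z, ← hA]
    rw [h2] at h1
    nth_rewrite 1 [h1]
    ext; simp
  · rw [hB]
    simp only [Matrix.transpose_sub, Matrix.transpose_mul, Matrix.transpose_transpose, hZ,
      Matrix.mul_neg, Matrix.neg_mul, Matrix.mul_assoc]
    abel
  · have e1 : Z = Z * vecMulVec χ p + Z * Qᵀ * Φᵀ := by
      rw [Matrix.mul_assoc, ← Matrix.mul_add, hQT, Matrix.mul_one]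
    have e2 : Q * A * vecMulVec χ p = Q * A - Q * A * Qᵀ * Φᵀ := by
      rw [eq_sub_iff_add_eq, Matrix.mul_assoc (Q * A), ← Matrix.mul_add, hQT, Matrix.mul_one]
    have e3 : Q *ᵥ (Φ *ᵥ (Z *ᵥ χ)) = (Q * A) *ᵥ χ := by
      simp only [hA, Matrix.mulVec_mulVec]
    rw [hB, Matrix.sub_mul, Matrix.sub_mul, Matrix.mul_assoc Q Zᵀ, hZΦ, Matrix.mul_neg, e3,
      Matrix.sub_vecMulVec, ← Matrix.mul_vecMulVec, ← Matrix.mul_vecMulVec, e2]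
    nth_rewrite 1 [e1]
    abel

/-! ### Matrices representing cycles, null chains and boundaries -/

section Matrices

variable {V : Type*} (G : SimpleGraph V)

/-- The unsigned vertex-edge incidence matrix of `G`, with columns indexed by the edges of `G`. -/
noncomputable def edgeMatrix : Matrix V G.edgeSet ℤ := fun u e => if u ∈ e.1 then 1 else 0

variable {G}

theorem edgeMatrix_mk {a b : V} (h : G.Adj a b) (u : V) :
    edgeMatrix G u ⟨s(a, b), h⟩ = (Pi.single a 1 : V → ℤ) u + (Pi.single b 1 : V → ℤ) u := by
  have := h.ne
  simp only [edgeMatrix, Sym2.mem_iff, Pi.single_apply]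
  by_cases h1 : u = a <;> by_cases h2 : u = b <;> simp_all

variable [Fintype V] (G)

/-- The matrices representing cycles in bidegree `(1, v - 2)`, where `Z` stands for the chain
`∑ Z e u • (e ⊗ u)`: those for which `ΦZ + (ΦZ)ᵀ` is diagonal, with `Φ` the incidence matrix. -/
def cycleMatrices : Submodule ℤ (Matrix G.edgeSet V ℤ) where
  carrier := {Z | ∀ a b, a ≠ b → (edgeMatrix G * Z) a b + (edgeMatrix G * Z) b a = 0}
  add_mem' := by
    intro Z W hZ hW a b hab
    have := hZ a b hab
    have := hW a b hab
    simp only [Matrix.mul_add, Matrix.add_apply]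
    linarith
  zero_mem' := by simp
  smul_mem' := by
    intro c Z hZ a b hab
    simp only [Matrix.mul_smul, Matrix.smul_apply, ← smul_add, hZ a b hab, smul_zero]

/-- The matrices representing the zero chain: the span of the `e ⊗ (a - b)` with `e = ab`, described
by the support and the sum of each row. -/
def nullMatrices : Submodule ℤ (Matrix G.edgeSet V ℤ) where
  carrier := {Z | (∀ e u, u ∉ e.1 → Z e u = 0) ∧ ∀ e, ∑ u, Z e u = 0}
  add_mem' := by
    rintro Z W ⟨h1, h2⟩ ⟨h3, h4⟩
    refine ⟨fun e u hu => by simp [h1 e u hu, h3 e u hu], fun e => ?_⟩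
    simp [Finset.sum_add_distrib, h2, h4]
  zero_mem' := by simp
  smul_mem' := by
    rintro c Z ⟨h1, h2⟩
    refine ⟨fun e u hu => by simp [h1 e u hu], fun e => ?_⟩
    simp [← Finset.mul_sum, h2]

/-- The matrices `B * Φᵀ` with `B` skew-symmetric, which represent boundaries. A basic choice of `B`
gives the Koszul relation `e ⊗ Φf - f ⊗ Φe`. -/
noncomputable def boundaryMatrices : Submodule ℤ (Matrix G.edgeSet V ℤ) where
  carrier := {Z | ∃ B : Matrix G.edgeSet G.edgeSet ℤ, Bᵀ = -B ∧ Z = B * (edgeMatrix G)ᵀ}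
  add_mem' := by
    rintro _ _ ⟨B, h1, rfl⟩ ⟨C, h2, rfl⟩
    exact ⟨B + C, by rw [Matrix.transpose_add, h1, h2]; abel, by rw [Matrix.add_mul]⟩
  zero_mem' := ⟨0, by simp, by simp⟩
  smul_mem' := by
    rintro c _ ⟨B, h1, rfl⟩
    exact ⟨c • B, by rw [Matrix.transpose_smul, h1, smul_neg], by rw [Matrix.smul_mul]⟩

variable {G}

theorem edgeMatrix_mulVec_single {a b : V} (h : G.Adj a b) :
    edgeMatrix G *ᵥ Pi.single (⟨s(a, b), h⟩ : G.edgeSet) 1 = Pi.single a 1 + Pi.single b 1 := by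
  ext u
  simp [edgeMatrix_mk h]

theorem sum_edgeMatrix (e : G.edgeSet) : ∑ u, edgeMatrix G u e = 2 := by
  obtain ⟨e, he⟩ := e
  induction e with | _ a b
  simp [edgeMatrix_mk he, Finset.sum_add_distrib]

/-- Null matrices move the diagonal entries of `ΦZ` along walks. -/
theorem exists_nullMatrices_of_reachable {a r : V} (h : G.Reachable a r) :
    ∃ X ∈ nullMatrices G, edgeMatrix G * X + (edgeMatrix G * X)ᵀ =
      (2 : ℤ) • (Matrix.single a a 1 - Matrix.single r r 1) := by
  obtain ⟨w⟩ := h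
  induction w with
  | nil => exact ⟨0, zero_mem _, by simp⟩
  | @cons a b r h w ih =>
    obtain ⟨X, hX, hX'⟩ := ih
    refine ⟨X + vecMulVec (Pi.single ⟨s(a, b), h⟩ 1) (Pi.single a 1 - Pi.single b 1),
      add_mem hX ⟨?_, ?_⟩, ?_⟩
    · rintro e u hu
      by_cases he : e = ⟨s(a, b), h⟩
      · subst he
        simp only [Sym2.mem_iff, not_or] at hu
        simp [vecMulVec_apply, hu]
      · simp [vecMulVec_apply, he]
    · intro e
      simp [vecMulVec_apply, ← Finset.mul_sum]
    · rw [Matrix.mul_add, Matrix.transpose_add, add_add_add_comm, hX', Matrix.mul_vecMulVec,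
        edgeMatrix_mulVec_single h, Matrix.transpose_vecMulVec,
        ← sub_add_sub_cancel (Matrix.single a a (1:ℤ)) (Matrix.single b b 1), smul_add, add_comm]
      congr 1
      ext u w
      simp only [Matrix.add_apply, vecMulVec_apply, Pi.add_apply, Pi.sub_apply, Matrix.smul_apply,
        Matrix.sub_apply, Matrix.single_apply, Pi.single_apply]
      by_cases h1 : u = a <;> by_cases h2 : w = a <;> by_cases h3 : u = b <;>
        by_cases h4 : w = b <;> simp_all <;> grind

/-- Along a walk, each vertex is congruent to minus the next one modulo the columns of the
incidence matrix. -/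
theorem exists_edgeMatrix_mulVec_of_walk {a r : V} (w : G.Walk a r) :
    ∃ q : G.edgeSet → ℤ, edgeMatrix G *ᵥ q = Pi.single a 1 - (-1) ^ w.length • Pi.single r 1 := by
  induction w with
  | nil => exact ⟨0, by simp⟩
  | @cons a b r h w ih =>
    obtain ⟨q, hq⟩ := ih
    refine ⟨Pi.single ⟨s(a, b), h⟩ 1 - q, ?_⟩
    rw [Matrix.mulVec_sub, edgeMatrix_mulVec_single h, hq, SimpleGraph.Walk.length_cons, pow_succ,
      mul_neg, mul_one, neg_smul]
    abel

theorem trace_eq_zero_of_skew {n : Type*} [Fintype n] {A : Matrix n n ℤ} (h : Aᵀ = -A) :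
    A.trace = 0 := by
  have := Matrix.trace_transpose A
  rw [h, Matrix.trace_neg] at this
  omega

theorem trace_eq_zero_of_mem_boundaryMatrices {Z : Matrix G.edgeSet V ℤ}
    (hZ : Z ∈ boundaryMatrices G) : (edgeMatrix G * Z).trace = 0 := by
  obtain ⟨B, hB, rfl⟩ := hZ
  apply trace_eq_zero_of_skew
  simp [Matrix.transpose_mul, hB, Matrix.mul_assoc]

theorem trace_eq_zero_of_mem_nullMatrices {Z : Matrix G.edgeSet V ℤ}
    (hZ : Z ∈ nullMatrices G) : (edgeMatrix G * Z).trace = 0 := by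
  simp only [Matrix.trace, Matrix.diag_apply, Matrix.mul_apply]
  rw [Finset.sum_comm]
  refine Finset.sum_eq_zero fun e _ => ?_
  rw [← hZ.2 e]
  refine Finset.sum_congr rfl fun u _ => ?_
  by_cases hu : u ∈ e.1
  · simp [edgeMatrix, hu]
  · simp [hZ.1 e u hu]

theorem mulVec_one_of_mem_nullMatrices {Z : Matrix G.edgeSet V ℤ}
    (hZ : Z ∈ nullMatrices G) : Z *ᵥ 1 = 0 := by
  ext e
  simpa [Matrix.mulVec, dotProduct] using hZ.2 e

theorem mulVec_one_of_boundary (B : Matrix G.edgeSet G.edgeSet ℤ) :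
    (B * (edgeMatrix G)ᵀ) *ᵥ 1 = (2 : ℤ) • (B *ᵥ 1) := by
  have : (edgeMatrix G)ᵀ *ᵥ 1 = (2 : ℤ) • 1 := by
    ext e
    simpa [Matrix.mulVec, dotProduct] using sum_edgeMatrix e
  rw [← Matrix.mulVec_mulVec, this, Matrix.mulVec_smul]

end Matrices

/-! ### The kernel of the incidence matrix and the invariants of cycles -/

/-- A direct summand `K = ker f` of `ℤⁿ` has mod-two coordinates that extend to all of `ℤⁿ`. -/
theorem exists_mod_two_coordinates {m n : Type*} [Fintype m] [Fintype n]
    (f : (n → ℤ) →ₗ[ℤ] (m → ℤ)) :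
    ∃ ψ : (n → ℤ) →+ (Fin (Module.finrank ℤ (LinearMap.ker f)) → ZMod 2),
      (∀ k ∈ LinearMap.ker f, ψ k = 0 → ∃ k' ∈ LinearMap.ker f, k = (2 : ℤ) • k') ∧
      ∀ y, ∃ k ∈ LinearMap.ker f, ψ k = y := by
  -- the range of `f` is free, so `f` splits onto its range and its kernel is a direct summand
  obtain ⟨σ, hσ⟩ := Module.projective_lifting_property f.rangeRestrict LinearMap.id
    f.surjective_rangeRestrict
  have hker : ∀ x, x - σ (f.rangeRestrict x) ∈ LinearMap.ker f := by
    intro x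
    have : f (σ (f.rangeRestrict x)) = f x :=
      congrArg Subtype.val (LinearMap.congr_fun hσ (f.rangeRestrict x))
    rw [LinearMap.mem_ker, map_sub, this, sub_self]
  let π : (n → ℤ) →ₗ[ℤ] LinearMap.ker f :=
    (LinearMap.id - σ ∘ₗ f.rangeRestrict).codRestrict _ hker
  have hπ : ∀ k : LinearMap.ker f, π k = k := by
    rintro ⟨k, hk⟩
    ext1
    have : f.rangeRestrict k = 0 := Subtype.ext hk
    simp [π, this]
  let b := Module.finBasis ℤ (LinearMap.ker f)
  let ψ : (n → ℤ) →+ (Fin (Module.finrank ℤ (LinearMap.ker f)) → ZMod 2) :=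
    { toFun := fun x i => (b.repr (π x) i : ZMod 2)
      map_zero' := by ext; simp
      map_add' := by intros; ext; simp }
  refine ⟨ψ, fun k hk h0 => ?_, fun y => ?_⟩
  · have h1 : ∀ i, (2 : ℤ) ∣ b.repr ⟨k, hk⟩ i := by
      intro i
      have h2 : ((b.repr (π k) i : ℤ) : ZMod 2) = 0 := congrFun h0 i
      have h3 := hπ ⟨k, hk⟩
      simp only at h3
      rw [h3] at h2
      exact (ZMod.intCast_zmod_eq_zero_iff_dvd _ 2).1 h2
    choose c hc using h1
    refine ⟨(∑ i, c i • b i : LinearMap.ker f), Subtype.property _, ?_⟩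
    have h4 : (⟨k, hk⟩ : LinearMap.ker f) = (2 : ℤ) • ∑ i, c i • b i := by
      conv_lhs => rw [← b.sum_repr ⟨k, hk⟩]
      rw [Finset.smul_sum]
      exact Finset.sum_congr rfl fun i _ => by rw [hc i, mul_smul]
    exact congrArg Subtype.val h4
  · have h1 : ∀ i, ∃ c : ℤ, (c : ZMod 2) = y i := fun i => ZMod.intCast_surjective _
    choose c hc using h1
    refine ⟨(∑ i, c i • b i : LinearMap.ker f), Subtype.property _, ?_⟩
    ext i
    change ((b.repr (π _) i : ℤ) : ZMod 2) = _
    rw [hπ, b.repr_sum_self, hc]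

theorem finrank_range_add_finrank_ker_int {M N : Type*} [AddCommGroup M] [AddCommGroup N]
    [Module.Finite ℤ M] (f : M →ₗ[ℤ] N) :
    Module.finrank ℤ (LinearMap.range f) + Module.finrank ℤ (LinearMap.ker f) =
      Module.finrank ℤ M := by
  rw [← f.quotKerEquivRange.finrank_eq, Submodule.finrank_quotient_add_finrank]

section Invariants

variable {V : Type*} {G : SimpleGraph V}

theorem edgeMatrix_mul_sq (u : V) (e : G.edgeSet) :
    edgeMatrix G u e * edgeMatrix G u e = edgeMatrix G u e := by
  unfold edgeMatrix; split_ifs <;> simp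

variable [Fintype V]

/-- If the trace condition holds, a cycle matrix can be changed by a null matrix so that its image
becomes skew-symmetric. -/
theorem exists_nullMatrices_skew (hG : G.Connected) {Z : Matrix G.edgeSet V ℤ}
    (hZ : Z ∈ cycleMatrices G) (htr : (edgeMatrix G * Z).trace = 0) :
    ∃ X ∈ nullMatrices G, (edgeMatrix G * (Z - X))ᵀ = -(edgeMatrix G * (Z - X)) := by
  obtain ⟨r⟩ := hG.nonempty
  choose X hX hX' using fun a => exists_nullMatrices_of_reachable (hG.preconnected a r)
  set A := edgeMatrix G * Z with hA
  have hsum : edgeMatrix G * (∑ a, A a a • X a) + (edgeMatrix G * ∑ a, A a a • X a)ᵀ =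
      (2 : ℤ) • Matrix.diagonal A.diag := by
    have h1 : ∀ a, edgeMatrix G * (A a a • X a) + (edgeMatrix G * (A a a • X a))ᵀ =
        (2 : ℤ) • (A a a • Matrix.single a a 1 - A a a • Matrix.single r r 1) := by
      intro a
      rw [Matrix.mul_smul, Matrix.transpose_smul, ← smul_add, hX', ← smul_sub, smul_comm]
    rw [Matrix.mul_sum, Matrix.transpose_sum, ← Finset.sum_add_distrib,
      Finset.sum_congr rfl fun a _ => h1 a, ← Finset.smul_sum, Finset.sum_sub_distrib,
      ← Finset.sum_smul]
    have h2 : ∑ a, A a a = 0 := htr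
    rw [h2, zero_smul, sub_zero]
    congr 1
    ext u w
    simp only [Matrix.sum_apply, Matrix.smul_apply, Matrix.single_apply, Matrix.diagonal_apply]
    by_cases huw : u = w
    · subst huw; simp
    · simp only [huw, if_false]
      refine Finset.sum_eq_zero fun a _ => ?_
      rw [if_neg (by rintro ⟨rfl, h⟩; exact huw h), smul_zero]
  refine ⟨∑ a, A a a • X a, Submodule.sum_mem _ fun a _ => Submodule.smul_mem _ _ (hX a), ?_⟩
  rw [eq_neg_iff_add_eq_zero, add_comm, Matrix.mul_sub, Matrix.transpose_sub,
    sub_add_sub_comm, hsum, ← hA]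
  ext u w
  simp only [Matrix.sub_apply, Matrix.add_apply, Matrix.transpose_apply, Matrix.smul_apply,
    Matrix.diagonal_apply, Matrix.diag_apply, Matrix.zero_apply]
  by_cases huw : u = w
  · subst huw
    rw [if_pos rfl, smul_eq_mul]
    ring
  · rw [if_neg huw, smul_zero, sub_zero, hZ u w huw]

/-- The relation `a ≡ χ a • r` modulo the columns of the incidence matrix, in matrix form. -/
theorem exists_vecMulVec_add_mul_eq_one {r : V} {χ : V → ℤ}
    (h : ∀ a, ∃ q : G.edgeSet → ℤ, edgeMatrix G *ᵥ q = Pi.single a 1 - χ a • Pi.single r 1) :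
    ∃ Q : Matrix G.edgeSet V ℤ, vecMulVec (Pi.single r 1) χ + edgeMatrix G * Q = 1 := by
  choose q hq using h
  refine ⟨Matrix.of fun e a => q a e, ?_⟩
  ext u a
  have := congrFun (hq a) u
  simp only [Matrix.mulVec, dotProduct, Pi.sub_apply, Pi.smul_apply, smul_eq_mul] at this
  simp only [Matrix.add_apply, vecMulVec_apply, Matrix.mul_apply, Matrix.of_apply, this]
  rw [Matrix.one_apply, Pi.single_apply]
  ring_nf
  simp [Pi.single_apply]

theorem mem_cycleMatrices_vecMulVec {k : G.edgeSet → ℤ} {r : V}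
    (hk : ∀ a, a ≠ r → (edgeMatrix G *ᵥ k) a = 0) :
    vecMulVec k (Pi.single r 1) ∈ cycleMatrices G := by
  intro a b hab
  rw [Matrix.mul_vecMulVec, vecMulVec_apply, vecMulVec_apply]
  by_cases ha : a = r
  · subst ha
    simp [hk b hab.symm, hab.symm]
  · simp [hk a ha, ha]

/-- A cycle matrix is null-homologous exactly when its trace and the mod-two class of its row
sums vanish. -/
theorem mem_sup_iff (hG : G.Connected) {r : V} {χ : V → ℤ}
    (hχ : ∀ a, ∃ q : G.edgeSet → ℤ, edgeMatrix G *ᵥ q = Pi.single a 1 - χ a • Pi.single r 1)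
    (h2 : ∀ k : G.edgeSet → ℤ, edgeMatrix G *ᵥ k = 0 →
      vecMulVec ((2 : ℤ) • k) (Pi.single r 1) ∈ nullMatrices G ⊔ boundaryMatrices G)
    {n : ℕ} (ψ : (G.edgeSet → ℤ) →+ (Fin n → ZMod 2))
    (hψ : ∀ k, edgeMatrix G *ᵥ k = 0 → ψ k = 0 →
      ∃ k', edgeMatrix G *ᵥ k' = 0 ∧ k = (2 : ℤ) • k')
    {Z : Matrix G.edgeSet V ℤ} (hZ : Z ∈ cycleMatrices G) :
    Z ∈ nullMatrices G ⊔ boundaryMatrices G ↔ ψ (Z *ᵥ 1) = 0 ∧ (edgeMatrix G * Z).trace = 0 := by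
  have hψ2 : ∀ x : G.edgeSet → ℤ, ψ ((2 : ℤ) • x) = 0 := by
    intro x
    rw [map_zsmul]
    ext i
    simp [show (2 : ZMod 2) = 0 from rfl]
  constructor
  · intro h
    obtain ⟨X, hX, Y, ⟨B, hB, rfl⟩, rfl⟩ := Submodule.mem_sup.1 h
    constructor
    · rw [Matrix.add_mulVec, mulVec_one_of_mem_nullMatrices hX, zero_add,
        mulVec_one_of_boundary, hψ2]
    · rw [Matrix.mul_add, Matrix.trace_add, trace_eq_zero_of_mem_nullMatrices hX,
        trace_eq_zero_of_mem_boundaryMatrices ⟨B, hB, rfl⟩, add_zero]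
  · rintro ⟨h0, htr⟩
    obtain ⟨X, hX, hskew⟩ := exists_nullMatrices_skew hG hZ htr
    obtain ⟨Q, hQ⟩ := exists_vecMulVec_add_mul_eq_one hχ
    obtain ⟨g, B, -, hg, hB, hZX⟩ := exists_eq_vecMulVec_add_mul_transpose _ Q _ χ hQ _ hskew
    have hψg : ψ g = 0 := by
      have h3 : (Z - X) *ᵥ 1 = g + (2 : ℤ) • (B *ᵥ 1) := by
        rw [hZX, Matrix.add_mulVec, mulVec_one_of_boundary, Matrix.vecMulVec_mulVec]
        simp
      rw [Matrix.sub_mulVec, mulVec_one_of_mem_nullMatrices hX, sub_zero] at h3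
      rwa [h3, map_add, hψ2, add_zero] at h0
    obtain ⟨k, hk, rfl⟩ := hψ g hg hψg
    rw [← sub_add_cancel Z X, hZX]
    exact add_mem (add_mem (h2 k hk) (Submodule.mem_sup_right ⟨B, hB, rfl⟩))
      (Submodule.mem_sup_left hX)

/-- If `2 r` is a combination of edges, then `2 k ⊗ r` is a Koszul boundary for each `k` in the
kernel. -/
theorem two_smul_mem_of_eq_two {r : V} {w : G.edgeSet → ℤ}
    (hw : edgeMatrix G *ᵥ w = (2 : ℤ) • Pi.single r 1) {k : G.edgeSet → ℤ}
    (hk : edgeMatrix G *ᵥ k = 0) :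
    vecMulVec ((2 : ℤ) • k) (Pi.single r 1) ∈ boundaryMatrices G := by
  refine ⟨vecMulVec k w - vecMulVec w k, ?_, ?_⟩
  · simp [Matrix.transpose_vecMulVec]
  · rw [Matrix.sub_mul, Matrix.vecMulVec_mul, Matrix.vecMulVec_mul, Matrix.vecMul_transpose,
      Matrix.vecMul_transpose, hk, hw]
    ext; simp [vecMulVec_apply]; ring

/-- For a two-colouring `χ` with values `±1`, the null matrix `∑ k e χ a • e ⊗ (a - b)` shows that
`2 k ⊗ r` is a null matrix plus a Koszul boundary. -/
theorem two_smul_mem_of_coloring {r : V} {χ : V → ℤ} (hχ1 : ∀ a, χ a * χ a = 1)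
    (hχadj : ∀ a b, G.Adj a b → χ a = - χ b)
    (hχ : ∀ a, ∃ q : G.edgeSet → ℤ, edgeMatrix G *ᵥ q = Pi.single a 1 - χ a • Pi.single r 1)
    {k : G.edgeSet → ℤ} (hk : edgeMatrix G *ᵥ k = 0) :
    vecMulVec ((2 : ℤ) • k) (Pi.single r 1) ∈ nullMatrices G ⊔ boundaryMatrices G := by
  obtain ⟨Q, hQ⟩ := exists_vecMulVec_add_mul_eq_one hχ
  let U : Matrix G.edgeSet V ℤ := Matrix.of fun e u => k e * edgeMatrix G u e * χ u
  have hU : U ∈ nullMatrices G := by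
    refine ⟨fun e u hu => by simp [U, edgeMatrix, hu], ?_⟩
    rintro ⟨e, he⟩
    induction e with | _ a b
    simp only [U, Matrix.of_apply, edgeMatrix_mk he, mul_assoc, ← Finset.mul_sum, add_mul,
      Finset.sum_add_distrib, Pi.single_apply, ite_mul, one_mul, zero_mul, Finset.sum_ite_eq', Finset.mem_univ, if_true,
      hχadj a b he]
    simp
  have hskew : (edgeMatrix G * U)ᵀ = -(edgeMatrix G * U) := by
    ext a b
    simp only [Matrix.transpose_apply, Matrix.neg_apply, Matrix.mul_apply, U, Matrix.of_apply]
    by_cases hab : a = b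
    · subst hab
      have h0 : ∑ e, edgeMatrix G a e * (k e * edgeMatrix G a e * χ a) = 0 := by
        have h1 : ∑ e, edgeMatrix G a e * k e = 0 := congrFun hk a
        calc _ = ∑ e, (edgeMatrix G a e * edgeMatrix G a e) * k e * χ a :=
              Finset.sum_congr rfl fun e _ => by ring
          _ = 0 := by simp only [edgeMatrix_mul_sq, ← Finset.sum_mul, h1, zero_mul]
      rw [h0, neg_zero]
    · rw [← Finset.sum_neg_distrib]
      refine Finset.sum_congr rfl fun e _ => ?_
      by_cases h : a ∈ e.1 ∧ b ∈ e.1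
      · have he : e.1 = s(a, b) := (Sym2.mem_and_mem_iff hab).1 h
        have hadj : G.Adj a b := by
          have := e.2
          rwa [he] at this
        rw [hχadj a b hadj]; ring
      · have : edgeMatrix G a e * edgeMatrix G b e = 0 := by
          unfold edgeMatrix
          by_cases h1 : a ∈ e.1 <;> by_cases h2 : b ∈ e.1 <;> simp_all
        linear_combination (k e * χ a + k e * χ b) * this
  obtain ⟨g, B, hg, -, hB, hUeq⟩ := exists_eq_vecMulVec_add_mul_transpose _ Q _ χ hQ U hskew
  have hUχ : U *ᵥ χ = (2 : ℤ) • k := by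
    ext e
    simp only [Matrix.mulVec, dotProduct, U, Matrix.of_apply, mul_assoc, hχ1, mul_one,
      ← Finset.mul_sum, sum_edgeMatrix]
    simp [mul_comm]
  rw [hUχ, Matrix.mulVec_smul, hk, smul_zero, Matrix.mulVec_zero, sub_zero] at hg
  subst hg
  rw [eq_sub_of_add_eq hUeq.symm]
  exact sub_mem (Submodule.mem_sup_left hU) (Submodule.mem_sup_right ⟨B, hB, rfl⟩)

theorem dotProduct_mulVec_of_mem_cycleMatrices {Z : Matrix G.edgeSet V ℤ}
    (hZ : Z ∈ cycleMatrices G) {x : V → ℤ} (hx : ∀ a, x a * x a = 1) :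
    x ⬝ᵥ ((edgeMatrix G * Z) *ᵥ x) = (edgeMatrix G * Z).trace := by
  set A := edgeMatrix G * Z with hA
  have h1 : A + Aᵀ = (2 : ℤ) • Matrix.diagonal A.diag := by
    ext a b
    by_cases hab : a = b
    · subst hab; simp; ring
    · have := hZ a b hab
      rw [← hA] at this
      simpa [Matrix.diagonal_apply, hab] using this
  have h2 : x ⬝ᵥ (Aᵀ *ᵥ x) = x ⬝ᵥ (A *ᵥ x) := by
    rw [Matrix.mulVec_transpose, Matrix.dotProduct_mulVec, dotProduct_comm]
  have h3 : x ⬝ᵥ ((A + Aᵀ) *ᵥ x) = 2 * A.trace := by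
    rw [h1, Matrix.smul_mulVec, dotProduct_smul, smul_eq_mul]
    congr 1
    simp only [dotProduct, Matrix.mulVec_diagonal, Matrix.trace]
    refine Finset.sum_congr rfl fun a _ => ?_
    linear_combination A.diag a * hx a
  rw [Matrix.add_mulVec, dotProduct_add, h2] at h3
  omega

theorem even_trace_of_mem_cycleMatrices {Z : Matrix G.edgeSet V ℤ} (hZ : Z ∈ cycleMatrices G) :
    Even (edgeMatrix G * Z).trace := by
  rw [← dotProduct_mulVec_of_mem_cycleMatrices hZ (x := 1) (by simp), ← Matrix.mulVec_mulVec,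
    Matrix.dotProduct_mulVec]
  have : (1 : V → ℤ) ᵥ* edgeMatrix G = (2 : ℤ) • 1 := by
    ext e
    simpa [Matrix.vecMul, dotProduct] using sum_edgeMatrix e
  rw [this, smul_dotProduct]
  exact ⟨_, two_mul _⟩

theorem vecMul_edgeMatrix_of_coloring {χ : V → ℤ} (hχadj : ∀ a b, G.Adj a b → χ a = - χ b) :
    χ ᵥ* edgeMatrix G = 0 := by
  ext ⟨e, he⟩
  induction e with | _ a b
  simp only [Matrix.vecMul, dotProduct, edgeMatrix_mk he, mul_add, Finset.sum_add_distrib]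
  simp [Pi.single_apply, hχadj a b he]

theorem trace_eq_zero_of_coloring {χ : V → ℤ} (hχ1 : ∀ a, χ a * χ a = 1)
    (hχadj : ∀ a b, G.Adj a b → χ a = - χ b) {Z : Matrix G.edgeSet V ℤ}
    (hZ : Z ∈ cycleMatrices G) : (edgeMatrix G * Z).trace = 0 := by
  rw [← dotProduct_mulVec_of_mem_cycleMatrices hZ hχ1, ← Matrix.mulVec_mulVec,
    Matrix.dotProduct_mulVec, vecMul_edgeMatrix_of_coloring hχadj, zero_dotProduct]

theorem finrank_ker_edgeMatrix_of_coloring {r : V} {χ : V → ℤ} (hr : χ r = 1)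
    (hχadj : ∀ a b, G.Adj a b → χ a = - χ b)
    (hχ : ∀ a, ∃ q : G.edgeSet → ℤ, edgeMatrix G *ᵥ q = Pi.single a 1 - χ a • Pi.single r 1) :
    Module.finrank ℤ (LinearMap.ker (edgeMatrix G).mulVecLin) + Fintype.card V =
      Fintype.card G.edgeSet + 1 := by
  obtain ⟨Q, hQ⟩ := exists_vecMulVec_add_mul_eq_one hχ
  let X : (V → ℤ) →ₗ[ℤ] ℤ := dotProductBilin ℤ ℤ χ
  have hX : LinearMap.ker X = LinearMap.range (edgeMatrix G).mulVecLin := by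
    ext m
    constructor
    · intro hm
      have hm : χ ⬝ᵥ m = 0 := hm
      refine ⟨Q *ᵥ m, ?_⟩
      have := congrArg (· *ᵥ m) hQ
      simp only [Matrix.add_mulVec, Matrix.vecMulVec_mulVec, hm, Matrix.one_mulVec] at this
      simpa using this
    · rintro ⟨x, rfl⟩
      change χ ⬝ᵥ (edgeMatrix G *ᵥ x) = 0
      rw [Matrix.dotProduct_mulVec, vecMul_edgeMatrix_of_coloring hχadj, zero_dotProduct]
  have hsurj : LinearMap.range X = ⊤ := by
    rw [LinearMap.range_eq_top]
    intro c
    exact ⟨Pi.single r c, by change χ ⬝ᵥ _ = c; simp [hr]⟩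
  have h1 := finrank_range_add_finrank_ker_int X
  have h2 := finrank_range_add_finrank_ker_int (edgeMatrix G).mulVecLin
  rw [hX, hsurj, finrank_top, Module.finrank_self, Module.finrank_fintype_fun_eq_card] at h1
  rw [Module.finrank_fintype_fun_eq_card] at h2
  omega

theorem finrank_ker_edgeMatrix_of_eq_two {r : V} {χ : V → ℤ} {w : G.edgeSet → ℤ}
    (hw : edgeMatrix G *ᵥ w = (2 : ℤ) • Pi.single r 1)
    (hχ : ∀ a, ∃ q : G.edgeSet → ℤ, edgeMatrix G *ᵥ q = Pi.single a 1 - χ a • Pi.single r 1) :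
    Module.finrank ℤ (LinearMap.ker (edgeMatrix G).mulVecLin) + Fintype.card V =
      Fintype.card G.edgeSet := by
  obtain ⟨Q, hQ⟩ := exists_vecMulVec_add_mul_eq_one hχ
  have hmem : ∀ m : V → ℤ, (2 : ℤ) • m ∈ LinearMap.range (edgeMatrix G).mulVecLin := by
    intro m
    refine ⟨(χ ⬝ᵥ m) • w + (2 : ℤ) • (Q *ᵥ m), ?_⟩
    have := congrArg (· *ᵥ m) hQ
    simp only [Matrix.add_mulVec, Matrix.vecMulVec_mulVec, Matrix.one_mulVec] at this
    rw [Matrix.mulVecLin_apply, Matrix.mulVec_add, Matrix.mulVec_smul, Matrix.mulVec_smul, hw,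
      Matrix.mulVec_mulVec]
    conv_rhs => rw [← this]
    ext; simp; ring
  have hle : Fintype.card V ≤ Module.finrank ℤ (LinearMap.range (edgeMatrix G).mulVecLin) := by
    rw [← Module.finrank_fintype_fun_eq_card (η := V) ℤ]
    refine LinearMap.finrank_le_finrank_of_injective
      (f := ((2 : ℤ) • LinearMap.id : (V → ℤ) →ₗ[ℤ] (V → ℤ)).codRestrict _ hmem) ?_
    intro x y hxy
    have h : (2 : ℤ) • x = (2 : ℤ) • y := congrArg Subtype.val hxy
    exact smul_right_injective _ (two_ne_zero) h
  have hge := Submodule.finrank_le (LinearMap.range (edgeMatrix G).mulVecLin)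
  have h2 := finrank_range_add_finrank_ker_int (edgeMatrix G).mulVecLin
  rw [Module.finrank_fintype_fun_eq_card] at h2 hge
  omega

end Invariants

/-! ### Components of spanning subgraphs and the states of the complex -/

section States

variable {V : Type*} {G : SimpleGraph V}

/-- The component of `[G : s]` containing a vertex. -/
abbrev comp (s : Finset G.edgeSet) (x : V) : Component s := (spanning s).connectedComponentMk x

theorem Label.ne_x_iff (l : Label) : l ≠ Label.x ↔ l = Label.one := by
  cases l <;> simp

theorem Label.ite_eq_ite {P Q : Prop} [Decidable P] [Decidable Q] :
    ((if P then Label.one else Label.x) = if Q then Label.one else Label.x) ↔ (P ↔ Q) := by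
  by_cases hP : P <;> by_cases hQ : Q <;> simp [hP, hQ]

theorem Label.ite_eq_x {P : Prop} [Decidable P] :
    (if P then Label.one else Label.x) = Label.x ↔ ¬P := by
  by_cases hP : P <;> simp [hP]

theorem spanning_adj {s : Finset G.edgeSet} {x y : V} :
    (spanning s).Adj x y ↔ ∃ h : G.Adj x y, (⟨s(x, y), h⟩ : G.edgeSet) ∈ s := by
  simp only [spanning, SimpleGraph.fromEdgeSet_adj, Set.mem_ofPred_eq]
  exact ⟨fun h => h.1, fun h => ⟨h, h.1.ne⟩⟩

theorem comp_empty {x y : V} : comp (G := G) ∅ x = comp ∅ y ↔ x = y := by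
  have h : spanning (G := G) ∅ = ⊥ := by
    ext x y
    simp [spanning_adj]
  rw [SimpleGraph.ConnectedComponent.eq, h, SimpleGraph.reachable_bot]

theorem exists_eq_mk (e : G.edgeSet) : ∃ p q : V, e.1 = s(p, q) :=
  ⟨_, _, (Quot.out_eq e.1).symm⟩

theorem adj_of_eq_mk {e : G.edgeSet} {p q : V} (h : e.1 = s(p, q)) : G.Adj p q := by
  have := e.2
  rwa [h] at this

theorem comp_eq_of_subset {s t : Finset G.edgeSet} (h : s ⊆ t) {x y : V}
    (hxy : comp s x = comp s y) : comp t x = comp t y :=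
  SimpleGraph.ConnectedComponent.sound
    ((SimpleGraph.ConnectedComponent.exact hxy).mono (spanning_mono h))

/-- Adding the edge `e = pq` merges the components of `p` and `q` and leaves the others unchanged. -/
theorem comp_insert {s t : Finset G.edgeSet} {e : G.edgeSet} {p q : V} (h : e.1 = s(p, q))
    (ht : insert e s = t) {x y : V} :
    comp t x = comp t y ↔
      comp s x = comp s y ∨ (comp s x = comp s p ∨ comp s x = comp s q) ∧
        (comp s y = comp s p ∨ comp s y = comp s q) := by
  have hsub : s ⊆ t := ht ▸ Finset.subset_insert _ _
  have hpq : comp t p = comp t q :=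
    SimpleGraph.ConnectedComponent.sound
      (spanning_adj.2 ⟨adj_of_eq_mk h, by
        rw [← ht, ← show e = ⟨s(p, q), adj_of_eq_mk h⟩ from Subtype.ext h]
        exact Finset.mem_insert_self _ _⟩).reachable
  constructor
  · intro hxy
    -- `g` sends a vertex to the component it has after the merger
    let g : V → Component s := fun z => if comp s z = comp s q then comp s p else comp s z
    have hg : g x = g y := by
      obtain ⟨w⟩ := SimpleGraph.ConnectedComponent.exact hxy
      induction w with
      | nil => rfl
      | @cons a b c hab w ih =>
        rw [← ih (SimpleGraph.ConnectedComponent.sound ⟨w⟩)]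
        obtain ⟨hab', hmem⟩ := spanning_adj.1 hab
        rcases Finset.mem_insert.1 (ht ▸ hmem) with he | he
        · rcases Sym2.eq_iff.1 ((congrArg Subtype.val he).trans h) with
            ⟨rfl, rfl⟩ | ⟨rfl, rfl⟩ <;> simp [g]
        · have : comp s a = comp s b :=
            SimpleGraph.ConnectedComponent.sound (spanning_adj.2 ⟨hab', he⟩).reachable
          simp only [g, this]
    simp only [g] at hg
    split_ifs at hg with h1 h2 h2
    · exact Or.inl (h1.trans h2.symm)
    · exact Or.inr ⟨Or.inr h1, Or.inl hg.symm⟩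
    · exact Or.inr ⟨Or.inl hg, Or.inr h2⟩
    · exact Or.inl hg
  · rintro (h1 | ⟨h1, h2⟩)
    · exact comp_eq_of_subset hsub h1
    · have key : ∀ z, comp s z = comp s p ∨ comp s z = comp s q →
          comp t z = comp t p := by
        rintro z (hz | hz)
        · exact comp_eq_of_subset hsub hz
        · exact (comp_eq_of_subset hsub hz).trans hpq.symm
      exact (key x h1).trans (key y h2).symm

theorem comp_singleton {e : G.edgeSet} {x y : V} :
    comp {e} x = comp {e} y ↔ x = y ∨ x ∈ e.1 ∧ y ∈ e.1 := by
  obtain ⟨p, q, h⟩ := exists_eq_mk e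
  rw [comp_insert (s := ∅) (t := {e}) h rfl, h]
  simp only [comp_empty, Sym2.mem_iff]

theorem card_component_empty [Fintype V] :
    Fintype.card (Component (∅ : Finset G.edgeSet)) = Fintype.card V := by
  refine (Fintype.card_of_bijective (f := comp (G := G) ∅) ⟨fun x y h => comp_empty.1 h, ?_⟩).symm
  intro c
  induction c using SimpleGraph.ConnectedComponent.ind with | _ v => exact ⟨v, rfl⟩

theorem card_component_insert [Fintype V] {s t : Finset G.edgeSet} {e : G.edgeSet} {p q : V}
    (h : e.1 = s(p, q))
    (ht : insert e s = t) (hpq : comp s p ≠ comp s q) :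
    Fintype.card (Component t) + 1 = Fintype.card (Component s) := by
  have hsub : s ⊆ t := ht ▸ Finset.subset_insert _ _
  have key : (Finset.univ.erase (comp s q)).card =
      (Finset.univ : Finset (Component t)).card := by
    refine Finset.card_bij (fun c _ => c.map (SimpleGraph.Hom.ofLE (spanning_mono hsub)))
      (fun _ _ => Finset.mem_univ _) ?_ ?_
    · intro c hc d hd hcd
      induction c using SimpleGraph.ConnectedComponent.ind with | _ x
      induction d using SimpleGraph.ConnectedComponent.ind with | _ y
      have hx := Finset.ne_of_mem_erase hc
      have hy := Finset.ne_of_mem_erase hd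
      rcases (comp_insert h ht).1 hcd with h1 | ⟨h1 | h1, h2 | h2⟩
      · exact h1
      · exact h1.trans h2.symm
      · exact absurd h2 hy
      · exact absurd h1 hx
      · exact absurd h1 hx
    · intro c' _
      induction c' using SimpleGraph.ConnectedComponent.ind with | _ y
      by_cases hy : comp s y = comp s q
      · exact ⟨comp s p, by simp [hpq], (comp_insert h ht).2 (Or.inr ⟨Or.inl rfl, Or.inr hy⟩)⟩
      · exact ⟨comp s y, by simp [hy], rfl⟩
  rw [Finset.card_erase_of_mem (Finset.mem_univ _), Finset.card_univ, Finset.card_univ] at key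
  have : 0 < Fintype.card (Component s) := Fintype.card_pos_iff.2 ⟨comp s q⟩
  omega

/-- The matrix entry of the multiplication map when the edge `e = pq` joins two components:
only the label of the merged component changes, to the product of two labels. -/
theorem mulCoeff_insert [Fintype V] {s t : Finset G.edgeSet} {e : G.edgeSet} {p q : V}
    (h : e.1 = s(p, q))
    (ht : insert e s = t) (hpq : comp s p ≠ comp s q)
    (a : Component s → Label) (b : Component t → Label) :
    mulCoeff a b = if (∀ x, comp s x ≠ comp s p → comp s x ≠ comp s q →
        b (comp t x) = a (comp s x)) ∧
      (if a (comp s p) = Label.x then 1 else 0) + (if a (comp s q) = Label.x then 1 else 0) =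
        (if b (comp t p) = Label.x then 1 else 0) then 1 else 0 := by
  have hsub : s ⊆ t := ht ▸ Finset.subset_insert _ _
  have hmerge : ∀ y, comp s y = comp s p ∨ comp s y = comp s q →
      (Finset.univ.filter fun c : Component s => a c = Label.x ∧
        c.map (SimpleGraph.Hom.ofLE (spanning_mono hsub)) = comp t y).card =
      (if a (comp s p) = Label.x then 1 else 0) + (if a (comp s q) = Label.x then 1 else 0) := by
    intro y hy
    rw [← Finset.sum_pair (f := fun c => if a c = Label.x then 1 else 0) hpq, ← Finset.card_filter]
    congr 1
    ext c
    induction c using SimpleGraph.ConnectedComponent.ind with | _ x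
    have : (comp s x).map (SimpleGraph.Hom.ofLE (spanning_mono hsub)) = comp t y ↔
        comp s x = comp s p ∨ comp s x = comp s q := by
      refine Iff.trans (comp_insert h ht) ?_
      constructor
      · rintro (h1 | h1)
        · exact (show comp s x = comp s y from h1) ▸ hy
        · exact h1.1
      · exact fun h1 => Or.inr ⟨h1, hy⟩
    simp only [Finset.mem_filter, Finset.mem_univ, true_and, Finset.mem_insert,
      Finset.mem_singleton]
    rw [this, and_comm]
  have hsingle : ∀ y, comp s y ≠ comp s p → comp s y ≠ comp s q →
      (Finset.univ.filter fun c : Component s => a c = Label.x ∧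
        c.map (SimpleGraph.Hom.ofLE (spanning_mono hsub)) = comp t y).card =
      (if a (comp s y) = Label.x then 1 else 0) := by
    intro y hyp hyq
    rw [← Finset.sum_singleton (fun c => if a c = Label.x then 1 else 0) (comp s y),
      ← Finset.card_filter]
    congr 1
    ext c
    induction c using SimpleGraph.ConnectedComponent.ind with | _ x
    have : (comp s x).map (SimpleGraph.Hom.ofLE (spanning_mono hsub)) = comp t y ↔
        comp s x = comp s y := by
      refine Iff.trans (comp_insert h ht) ?_
      simp [hyp, hyq]
    simp only [Finset.mem_filter, Finset.mem_univ, true_and, Finset.mem_singleton]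
    rw [this, and_comm]
  rw [mulCoeff_eq hsub]
  refine if_congr ⟨fun H => ⟨fun x hp hq => ?_, ?_⟩, fun H c' => ?_⟩ rfl rfl
  · have := H (comp t x)
    rw [hsingle x hp hq] at this
    cases h1 : a (comp s x) <;> cases h2 : b (comp t x) <;> simp [h1, h2] at this ⊢
  · rw [← hmerge p (Or.inl rfl)]
    exact H (comp t p)
  · induction c' using SimpleGraph.ConnectedComponent.ind with | _ y
    by_cases hy : comp s y = comp s p ∨ comp s y = comp s q
    · refine (hmerge y hy).trans (H.2.trans ?_)
      have : comp t p = comp t y := (comp_insert h ht).2 (Or.inr ⟨Or.inl rfl, hy⟩)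
      rw [this]
    · rw [not_or] at hy
      refine (hsingle y hy.1 hy.2).trans ?_
      rw [← H.1 y hy.1 hy.2]

/-- Extensionality for states that avoids comparing labellings of different types of components. -/
theorem EnhancedState.ext_comp [Finite V] {i : ℕ} {j : ℤ} {S T : EnhancedState G i j}
    (h : S.edges = T.edges)
    (hl : ∀ x, S.label (comp S.edges x) = T.label (comp T.edges x)) : S = T := by
  obtain ⟨s, a, h1, h2⟩ := S
  obtain ⟨t, b, h3, h4⟩ := T
  change s = t at h
  subst h
  congr 1
  funext c
  induction c using SimpleGraph.ConnectedComponent.ind with | _ x => exact hl x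

theorem card_filter_x_add_card_filter_one [Finite V] {s : Finset G.edgeSet}
    (a : Component s → Label) :
    (Finset.univ.filter fun c => a c = Label.x).card +
      (Finset.univ.filter fun c => a c = Label.one).card = Fintype.card (Component s) := by
  simp only [← Label.ne_x_iff]
  rw [← Finset.card_univ]
  exact Finset.card_filter_add_card_filter_not _

theorem comp_ne_of_ne {e f : G.edgeSet} {p q : V} (hf : f.1 = s(p, q)) (hne : e ≠ f) :
    comp {e} p ≠ comp {e} q := by
  have hpq := (adj_of_eq_mk hf).ne
  rw [Ne, comp_singleton]
  rintro (h1 | h1)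
  · exact hpq h1
  · exact hne (Subtype.ext (((Sym2.mem_and_mem_iff hpq).1 h1).trans hf.symm))

theorem card_component_singleton [Fintype V] (e : G.edgeSet) :
    Fintype.card (Component {e}) + 1 = Fintype.card V := by
  obtain ⟨p, q, h⟩ := exists_eq_mk e
  rw [← card_component_empty (G := G)]
  exact card_component_insert h rfl (by rw [Ne, comp_empty]; exact (adj_of_eq_mk h).ne)

theorem card_component_pair [Fintype V] {e f : G.edgeSet} (h : e ≠ f) :
    Fintype.card (Component (insert f {e})) + 2 = Fintype.card V := by
  obtain ⟨p, q, hf⟩ := exists_eq_mk f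
  rw [← card_component_singleton e, ← card_component_insert hf rfl (comp_ne_of_ne hf h)]

variable [Fintype V]

/-- The state with no edges in which exactly `a` and `b` are labelled `1`. -/
noncomputable def vertexState {a b : V} (hab : a ≠ b) :
    EnhancedState G 0 ((Nat.card V : ℤ) - 2) where
  edges := ∅
  label := fun c => if c = comp ∅ a ∨ c = comp ∅ b then Label.one else Label.x
  card_edges := rfl
  card_x := by
    have h1 := card_filter_x_add_card_filter_one
      fun c : Component (∅ : Finset G.edgeSet) =>
        if c = comp ∅ a ∨ c = comp ∅ b then Label.one else Label.x
    have h2 : (Finset.univ.filter fun c : Component (∅ : Finset G.edgeSet) =>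
        (if c = comp ∅ a ∨ c = comp ∅ b then Label.one else Label.x) = Label.one) =
        {comp ∅ a, comp ∅ b} := by
      ext c
      simp only [Finset.mem_filter, Finset.mem_univ, true_and, Finset.mem_insert,
        Finset.mem_singleton]
      split_ifs with h <;> simp [h]
    rw [h2, Finset.card_pair (by rwa [Ne, comp_empty]), card_component_empty] at h1
    rw [Nat.card_eq_fintype_card, ← h1]
    push_cast
    ring

/-- The state with the single edge `e` in which only the component of `u` is labelled `1`. -/
noncomputable def edgeState (e : G.edgeSet) (u : V) :
    EnhancedState G 1 ((Nat.card V : ℤ) - 2) where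
  edges := {e}
  label := fun c => if c = comp {e} u then Label.one else Label.x
  card_edges := rfl
  card_x := by
    have h1 := card_filter_x_add_card_filter_one
      fun c : Component {e} => if c = comp {e} u then Label.one else Label.x
    have h2 : (Finset.univ.filter fun c : Component {e} =>
        (if c = comp {e} u then Label.one else Label.x) = Label.one) = {comp {e} u} := by
      ext c
      simp
    rw [h2, Finset.card_singleton] at h1
    rw [Nat.card_eq_fintype_card, ← card_component_singleton e, ← h1]
    push_cast
    ring

/-- The state with edges `e` and `f` in which every component is labelled `x`. -/
noncomputable def pairState {e f : G.edgeSet} (h : e ≠ f) :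
    EnhancedState G 2 ((Nat.card V : ℤ) - 2) where
  edges := insert f {e}
  label := fun _ => Label.x
  card_edges := by rw [Finset.card_insert_of_notMem (by simpa using h.symm)]; rfl
  card_x := by
    simp only [Finset.filter_true, Finset.card_univ]
    rw [Nat.card_eq_fintype_card, ← card_component_pair h]
    push_cast
    ring

theorem exists_eq_vertexState (S : EnhancedState G 0 ((Nat.card V : ℤ) - 2)) :
    ∃ (a b : V) (hab : a ≠ b), S = vertexState hab := by
  obtain ⟨s, l, hs, hx⟩ := S
  obtain rfl := Finset.card_eq_zero.1 hs
  have h1 := card_filter_x_add_card_filter_one l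
  rw [card_component_empty] at h1
  rw [Nat.card_eq_fintype_card] at hx
  have h2 : (Finset.univ.filter fun c => l c = Label.one).card = 2 := by omega
  obtain ⟨c, d, hcd, h3⟩ := Finset.card_eq_two.1 h2
  induction c using SimpleGraph.ConnectedComponent.ind with | _ a
  induction d using SimpleGraph.ConnectedComponent.ind with | _ b
  refine ⟨a, b, fun h => hcd (by rw [h]), EnhancedState.ext_comp rfl fun x => ?_⟩
  have h4 := Finset.ext_iff.1 h3 (comp ∅ x)
  simp only [Finset.mem_filter, Finset.mem_univ, true_and, Finset.mem_insert,
    Finset.mem_singleton] at h4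
  simp only [vertexState]
  split_ifs with h5
  · exact h4.2 h5
  · by_contra h6
    exact h5 (h4.1 ((Label.ne_x_iff _).1 h6))

theorem exists_eq_edgeState (T : EnhancedState G 1 ((Nat.card V : ℤ) - 2)) :
    ∃ (e : G.edgeSet) (u : V), T = edgeState e u := by
  obtain ⟨s, l, hs, hx⟩ := T
  obtain ⟨e, rfl⟩ := Finset.card_eq_one.1 hs
  have h1 := card_filter_x_add_card_filter_one l
  have h0 := card_component_singleton e
  rw [Nat.card_eq_fintype_card] at hx
  have h2 : (Finset.univ.filter fun c => l c = Label.one).card = 1 := by omega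
  obtain ⟨c, h3⟩ := Finset.card_eq_one.1 h2
  induction c using SimpleGraph.ConnectedComponent.ind with | _ u
  refine ⟨e, u, EnhancedState.ext_comp rfl fun x => ?_⟩
  have h4 := Finset.ext_iff.1 h3 (comp {e} x)
  simp only [Finset.mem_filter, Finset.mem_univ, true_and, Finset.mem_singleton] at h4
  simp only [edgeState]
  split_ifs with h5
  · exact h4.2 h5
  · by_contra h6
    exact h5 (h4.1 ((Label.ne_x_iff _).1 h6))

theorem eq_pairState {e f : G.edgeSet} (h : e ≠ f) (U : EnhancedState G 2 ((Nat.card V : ℤ) - 2))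
    (hU : insert f {e} = U.edges) : U = pairState h := by
  obtain ⟨s, l, hs, hx⟩ := U
  change _ = s at hU
  subst hU
  have h1 := card_filter_x_add_card_filter_one l
  have h0 := card_component_pair h
  rw [Nat.card_eq_fintype_card] at hx
  have h2 : (Finset.univ.filter fun c => l c = Label.one).card = 0 := by omega
  refine EnhancedState.ext_comp rfl fun x => ?_
  by_contra h6
  have h7 : comp (insert f {e}) x ∈ Finset.univ.filter fun c => l c = Label.one := by
    simpa using (Label.ne_x_iff _).1 h6
  rw [Finset.card_eq_zero.1 h2] at h7
  simp at h7

theorem exists_eq_pairState (U : EnhancedState G 2 ((Nat.card V : ℤ) - 2)) :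
    ∃ (e f : G.edgeSet) (h : e ≠ f), U = pairState h := by
  obtain ⟨e, f, h, hU⟩ := Finset.card_eq_two.1 U.card_edges
  exact ⟨e, f, h, eq_pairState h U (by rw [hU, Finset.pair_comm])⟩

theorem pairState_symm {e f : G.edgeSet} (h : e ≠ f) : pairState h.symm = pairState h :=
  eq_pairState h _ (Finset.pair_comm f e)

theorem edgeState_eq_iff {e f : G.edgeSet} {u w : V} :
    edgeState e u = edgeState f w ↔ e = f ∧ (u = w ∨ u ∈ e.1 ∧ w ∈ e.1) := by
  constructor
  · intro h
    have h1 : e = f := Finset.singleton_injective (congrArg EnhancedState.edges h)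
    subst h1
    refine ⟨rfl, ?_⟩
    have h2 : (edgeState e u).label = (edgeState e w).label := by
      injection h with _ h
    have h3 := congrFun h2 (comp {e} u)
    rw [← comp_singleton]
    by_contra h4
    simp [edgeState, h4] at h3
  · rintro ⟨rfl, h⟩
    rw [← comp_singleton] at h
    simp only [edgeState, h]

end States

/-! ### The boundary maps in terms of matrices -/

section Boundary

variable {V : Type*} {G : SimpleGraph V}

theorem edgeSign_singleton (ord : LinearOrder G.edgeSet) {e f : G.edgeSet} (h : e ≠ f) :
    edgeSign ord {e} f = - edgeSign ord {f} e := by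
  have h0 := edgeSign_insert_add ord ∅ (Finset.notMem_empty e) (Finset.notMem_empty f) h
  have h1 : ∀ g : G.edgeSet, edgeSign ord ∅ g = 1 := fun g => by simp [edgeSign]
  rw [h1, h1, one_mul, one_mul] at h0
  exact eq_neg_of_add_eq_zero_left h0

theorem edgeSign_mul_self (ord : LinearOrder G.edgeSet) (s : Finset G.edgeSet) (e : G.edgeSet) :
    edgeSign ord s e * edgeSign ord s e = 1 := by
  rw [edgeSign, ← mul_pow]
  norm_num

variable [Fintype V]

/-- The matrix entry from the pair `{a, b}` to `e ⊗ u` is nonzero exactly when `e` contains one of the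
two vertices and the other is in the component of `u`. -/
theorem incidence_vertexState (ord : LinearOrder G.edgeSet) {a b : V} (hab : a ≠ b)
    (e : G.edgeSet) (u : V) :
    incidence G ord 0 ((Nat.card V : ℤ) - 2) (vertexState hab) (edgeState e u) =
      (if a ∈ e.1 ∧ (b = u ∨ b ∈ e.1 ∧ u ∈ e.1) then 1 else 0) +
      (if b ∈ e.1 ∧ a ∉ e.1 ∧ a = u then 1 else 0) := by
  have h1 : incidence G ord 0 ((Nat.card V : ℤ) - 2) (vertexState hab) (edgeState e u) =
      mulCoeff (vertexState hab).label (edgeState e u).label := by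
    simp [incidence, vertexState, edgeState, edgeSign]
  obtain ⟨p, q, he⟩ := exists_eq_mk e
  have hne : p ≠ q := (adj_of_eq_mk he).ne
  have h2 := mulCoeff_insert (s := ∅) (t := {e}) he rfl (by rwa [Ne, comp_empty])
    (vertexState hab).label (edgeState e u).label
  refine h1.trans (h2.trans ?_)
  simp only [vertexState, edgeState, comp_empty, comp_singleton, he, Sym2.mem_iff,
    Label.ite_eq_ite, Label.ite_eq_x, ne_eq]
  have key : ((∀ x, ¬x = p → ¬x = q → ((x = u ∨ (x = p ∨ x = q) ∧ (u = p ∨ u = q)) ↔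
      (x = a ∨ x = b))) ∧ ((if ¬(p = a ∨ p = b) then 1 else 0) +
        (if ¬(q = a ∨ q = b) then 1 else 0) =
        if ¬(p = u ∨ (True ∨ p = q) ∧ (u = p ∨ u = q)) then 1 else 0)) ↔
      ((a = p ∨ a = q) ∧ (b = u ∨ (b = p ∨ b = q) ∧ (u = p ∨ u = q)) ∨
        (b = p ∨ b = q) ∧ ¬(a = p ∨ a = q) ∧ a = u) := by
    constructor
    · rintro ⟨h, h'⟩
      have ha := h a
      have hb := h b
      have hu := h u
      grind
    · intro h
      refine ⟨?_, ?_⟩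
      · intro x; grind
      · grind
  refine (if_congr key rfl rfl).trans ?_
  grind

/-- The chain in bidegree `(1, v - 2)` represented by `∑ Z e u • (e ⊗ u)`, where `e ⊗ u` is the
state `edgeState e u`. Its coefficient at a state is the sum of the entries of `Z` over the vertices
of the component labelled `1`. -/
noncomputable def chainOf (G : SimpleGraph V) :
    Matrix G.edgeSet V ℤ →ₗ[ℤ] ChainGroup G 1 ((Nat.card V : ℤ) - 2) where
  toFun Z T := ∑ e ∈ T.edges, ∑ u, if T.label (comp T.edges u) = Label.one then Z e u else 0
  map_add' Z W := by
    ext T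
    simp only [Pi.add_apply, Matrix.add_apply, ← Finset.sum_add_distrib]
    refine Finset.sum_congr rfl fun e _ => Finset.sum_congr rfl fun u _ => ?_
    split_ifs <;> simp
  map_smul' c Z := by
    ext T
    simp only [Pi.smul_apply, Matrix.smul_apply, Finset.smul_sum, RingHom.id_apply]
    refine Finset.sum_congr rfl fun e _ => Finset.sum_congr rfl fun u _ => ?_
    split_ifs <;> simp

theorem chainOf_edgeState (Z : Matrix G.edgeSet V ℤ) (e : G.edgeSet) (u : V) :
    chainOf G Z (edgeState e u) = ∑ w, if w = u ∨ w ∈ e.1 ∧ u ∈ e.1 then Z e w else 0 := by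
  have h : ∀ w, (edgeState e u).label (comp (edgeState e u).edges w) = Label.one ↔
      w = u ∨ w ∈ e.1 ∧ u ∈ e.1 := by
    intro w
    rw [← comp_singleton]
    change (if comp {e} w = comp {e} u then Label.one else Label.x) = _ ↔ _
    split_ifs with h <;> simp [h]
  change ∑ e' ∈ ({e} : Finset G.edgeSet), ∑ w, (if (edgeState e u).label
    (comp (edgeState e u).edges w) = Label.one then Z e' w else 0) = _
  rw [Finset.sum_singleton]
  exact Finset.sum_congr rfl fun w _ => if_congr (h w) rfl rfl

theorem chainOf_edgeState_of_notMem (Z : Matrix G.edgeSet V ℤ) {e : G.edgeSet} {u : V}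
    (hu : u ∉ e.1) : chainOf G Z (edgeState e u) = Z e u := by
  rw [chainOf_edgeState]
  simp [hu]

theorem chainOf_edgeState_of_mem (Z : Matrix G.edgeSet V ℤ) {e : G.edgeSet} {u : V}
    (hu : u ∈ e.1) : chainOf G Z (edgeState e u) = ∑ w, if w ∈ e.1 then Z e w else 0 := by
  rw [chainOf_edgeState]
  refine Finset.sum_congr rfl fun w _ => if_congr ⟨?_, fun h => Or.inr ⟨h, hu⟩⟩ rfl rfl
  rintro (rfl | h)
  exacts [hu, h.1]

theorem chainOf_surjective : Function.Surjective (chainOf G) := by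
  intro z
  -- both endpoints of `e` give the same state, whose coefficient is placed at one of them
  let Z : Matrix G.edgeSet V ℤ := Matrix.of fun e u =>
    if u ∈ e.1 then if u = (Quot.out e.1).1 then z (edgeState e u) else 0 else z (edgeState e u)
  refine ⟨Z, ?_⟩
  ext T
  obtain ⟨e, u, rfl⟩ := exists_eq_edgeState T
  by_cases hu : u ∈ e.1
  · have h0 : (Quot.out e.1).1 ∈ e.1 := Sym2.out_fst_mem _
    rw [chainOf_edgeState_of_mem _ hu, Finset.sum_eq_single (Quot.out e.1).1]
    · rw [if_pos h0]
      simp only [Z, Matrix.of_apply, h0, if_true]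
      congr 1
      exact edgeState_eq_iff.2 ⟨rfl, Or.inr ⟨h0, hu⟩⟩
    · intro w _ hw
      by_cases hwe : w ∈ e.1 <;> simp [Z, hwe, hw]
    · simp
  · rw [chainOf_edgeState_of_notMem _ hu]
    simp [Z, hu]

theorem chainOf_eq_zero_iff {Z : Matrix G.edgeSet V ℤ} :
    chainOf G Z = 0 ↔ Z ∈ nullMatrices G := by
  have hsum : ∀ e : G.edgeSet, (∀ u, u ∉ e.1 → Z e u = 0) →
      ∑ w, (if w ∈ e.1 then Z e w else 0) = ∑ w, Z e w := by
    intro e h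
    refine Finset.sum_congr rfl fun w _ => ?_
    split_ifs with hw
    · rfl
    · rw [h w hw]
  constructor
  · intro h
    have h1 : ∀ (e : G.edgeSet) (u : V), u ∉ e.1 → Z e u = 0 := by
      intro e u hu
      rw [← chainOf_edgeState_of_notMem Z hu, h]
      rfl
    refine ⟨h1, fun e => ?_⟩
    rw [← hsum e (h1 e), ← chainOf_edgeState_of_mem Z (Sym2.out_fst_mem e.1), h]
    rfl
  · rintro ⟨h1, h2⟩
    ext T
    obtain ⟨e, u, rfl⟩ := exists_eq_edgeState T
    by_cases hu : u ∈ e.1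
    · rw [chainOf_edgeState_of_mem _ hu, hsum e (h1 e), h2]
      rfl
    · rw [chainOf_edgeState_of_notMem _ hu, h1 e u hu]
      rfl

theorem boundary_chainOf (ord : LinearOrder G.edgeSet) (Z : Matrix G.edgeSet V ℤ) {a b : V}
    (hab : a ≠ b) :
    boundary G ord 0 ((Nat.card V : ℤ) - 2) (chainOf G Z) (vertexState hab) =
      (edgeMatrix G * Z) a b + (edgeMatrix G * Z) b a := by
  have h1 : ∀ T : EnhancedState G 1 ((Nat.card V : ℤ) - 2),
      incidence G ord 0 ((Nat.card V : ℤ) - 2) (vertexState hab) T = ∑ e : G.edgeSet,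
        ((if edgeState e b = T then (if a ∈ e.1 then 1 else 0) else 0) +
        if edgeState e a = T then (if b ∈ e.1 ∧ a ∉ e.1 then 1 else 0) else 0) := by
    intro T
    obtain ⟨e, u, rfl⟩ := exists_eq_edgeState T
    rw [incidence_vertexState, Finset.sum_eq_single e]
    · simp only [edgeState_eq_iff, true_and]
      grind
    · intro f _ hf
      simp [edgeState_eq_iff, hf]
    · simp
  change ∑ T, incidence G ord 0 ((Nat.card V : ℤ) - 2) (vertexState hab) T * chainOf G Z T = _
  simp only [h1, Finset.sum_mul]
  rw [Finset.sum_comm, Matrix.mul_apply, Matrix.mul_apply, ← Finset.sum_add_distrib]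
  refine Finset.sum_congr rfl fun e _ => ?_
  simp only [add_mul, Finset.sum_add_distrib, ite_mul, zero_mul, one_mul, Finset.sum_ite_eq,
    Finset.mem_univ, if_true]
  by_cases ha : a ∈ e.1 <;> by_cases hb : b ∈ e.1
  · have he : e.1 = s(a, b) := (Sym2.mem_and_mem_iff hab).1 ⟨ha, hb⟩
    rw [chainOf_edgeState_of_mem Z hb]
    have hw : ∀ w, (if w ∈ e.1 then Z e w else 0) =
        (if w = a then Z e w else 0) + if w = b then Z e w else 0 := by
      intro w
      simp only [he, Sym2.mem_iff]
      grind
    simp only [hw, Finset.sum_add_distrib, Finset.sum_ite_eq', Finset.mem_univ, if_true,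
      edgeMatrix, ha, hb]
    simp [add_comm]
  · simp [chainOf_edgeState_of_notMem Z hb, edgeMatrix, ha, hb]
  · simp [chainOf_edgeState_of_notMem Z ha, edgeMatrix, ha, hb]
  · simp [edgeMatrix, ha, hb]

theorem chainOf_mem_cycles_iff (ord : LinearOrder G.edgeSet) {Z : Matrix G.edgeSet V ℤ} :
    chainOf G Z ∈ cycles G ord 1 ((Nat.card V : ℤ) - 2) ↔ Z ∈ cycleMatrices G := by
  constructor
  · intro h a b hab
    rw [← boundary_chainOf ord Z hab]
    exact congrFun (LinearMap.mem_ker.1 h) (vertexState hab)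
  · intro h
    refine LinearMap.mem_ker.2 ?_
    ext S
    obtain ⟨a, b, hab, rfl⟩ := exists_eq_vertexState S
    exact (boundary_chainOf ord Z hab).trans (h a b hab)

/-- The matrix entry from `e ⊗ u` to the pair `{e, f}`, without its sign, counts the endpoints of `f` in
the component of `u` in `[G : {e}]`. -/
theorem mulCoeff_pairState {e f : G.edgeSet} (h : e ≠ f) (u : V) :
    mulCoeff (edgeState e u).label (pairState h).label =
      ∑ w, if w = u ∨ w ∈ e.1 ∧ u ∈ e.1 then edgeMatrix G w f else 0 := by
  obtain ⟨p, q, hf⟩ := exists_eq_mk f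
  have hne : p ≠ q := (adj_of_eq_mk hf).ne
  have hpq := comp_ne_of_ne hf h
  have h2 := mulCoeff_insert (s := {e}) (t := insert f {e}) hf rfl hpq
    (edgeState e u).label (pairState h).label
  refine h2.trans ?_
  have h3 : ∀ w, (if w = u ∨ w ∈ e.1 ∧ u ∈ e.1 then edgeMatrix G w f else 0) =
      (if w = p then (if comp {e} p = comp {e} u then 1 else 0) else 0) +
      (if w = q then (if comp {e} q = comp {e} u then 1 else 0) else 0) := by
    intro w
    simp only [← comp_singleton, edgeMatrix, hf, Sym2.mem_iff]
    grind
  simp only [h3, Finset.sum_add_distrib, Finset.sum_ite_eq', Finset.mem_univ, if_true]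
  simp only [pairState, edgeState, Label.ite_eq_x, if_true, ne_eq]
  have key : ((∀ x, ¬comp {e} x = comp {e} p → ¬comp {e} x = comp {e} q →
        Label.x = if comp {e} x = comp {e} u then Label.one else Label.x) ∧
      (if ¬comp {e} p = comp {e} u then 1 else 0) +
        (if ¬comp {e} q = comp {e} u then 1 else 0) = 1) ↔
      (comp {e} p = comp {e} u ∨ comp {e} q = comp {e} u) := by
    constructor
    · rintro ⟨_, h'⟩
      by_contra h4
      rw [not_or] at h4
      simp [h4] at h'
    · intro h4
      refine ⟨fun x h5 h6 => ?_, ?_⟩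
      · rw [if_neg]
        intro h7
        rcases h4 with h4 | h4
        · exact h5 (h7.trans h4.symm)
        · exact h6 (h7.trans h4.symm)
      · rcases h4 with h4 | h4
        · have : comp {e} q ≠ comp {e} u := fun h5 => hpq (h4.trans h5.symm)
          rw [if_neg (not_not.2 h4), if_pos this]
        · have : comp {e} p ≠ comp {e} u := fun h5 => hpq (h5.trans h4.symm)
          rw [if_pos this, if_neg (not_not.2 h4)]
  rw [if_congr key rfl rfl]
  by_cases h4 : comp {e} p = comp {e} u
  · have : comp {e} q ≠ comp {e} u := fun h5 => hpq (h4.trans h5.symm)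
    rw [if_pos (Or.inl h4), if_pos h4, if_neg this, add_zero]
  · rw [if_neg h4, zero_add]
    exact if_congr (by simp [h4]) rfl rfl

theorem incidence_edgeState (ord : LinearOrder G.edgeSet) (e : G.edgeSet) (u : V)
    (U : EnhancedState G 2 ((Nat.card V : ℤ) - 2)) :
    incidence G ord 1 ((Nat.card V : ℤ) - 2) (edgeState e u) U =
      ∑ f, if h : e ≠ f then if pairState h = U then edgeSign ord {e} f *
        ∑ w, (if w = u ∨ w ∈ e.1 ∧ u ∈ e.1 then edgeMatrix G w f else 0) else 0 else 0 := by
  rw [incidence]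
  refine Finset.sum_subset_zero_on_sdiff (Finset.subset_univ _) ?_ ?_
  · intro f hf
    split_ifs with h hU
    · exfalso
      subst hU
      simp only [Finset.mem_sdiff, Finset.mem_univ, true_and, not_and, not_not] at hf
      have h1 : f ∈ ({e} : Finset G.edgeSet) := hf (Finset.mem_insert_self f {e})
      exact h (Finset.mem_singleton.1 h1).symm
    · rfl
    · rfl
  · intro f hf
    have hne : e ≠ f := by
      rintro rfl
      exact (Finset.mem_sdiff.1 hf).2 (Finset.mem_singleton_self e)
    rw [dif_pos hne]
    by_cases hU : insert f {e} = U.edges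
    · obtain rfl := eq_pairState hne U hU
      rw [if_pos rfl, ← mulCoeff_pairState hne]
      exact if_pos rfl
    · refine (if_neg hU).trans (if_neg ?_).symm
      rintro rfl
      exact hU rfl

/-- The skew-symmetric matrix of a chain in bidegree `(2, v - 2)`. The sign of the complex is used to
orient each pair of edges. -/
noncomputable def skewOf (ord : LinearOrder G.edgeSet)
    (y : ChainGroup G 2 ((Nat.card V : ℤ) - 2)) : Matrix G.edgeSet G.edgeSet ℤ :=
  Matrix.of fun e f => if h : e ≠ f then edgeSign ord {e} f * y (pairState h) else 0

theorem skewOf_transpose (ord : LinearOrder G.edgeSet)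
    (y : ChainGroup G 2 ((Nat.card V : ℤ) - 2)) : (skewOf ord y)ᵀ = -skewOf ord y := by
  ext e f
  simp only [skewOf, Matrix.transpose_apply, Matrix.of_apply, Matrix.neg_apply]
  by_cases h : e = f
  · subst h; simp
  · rw [dif_pos h, dif_pos (Ne.symm h), edgeSign_singleton ord h, pairState_symm h]
    ring

theorem exists_skewOf_eq (ord : LinearOrder G.edgeSet) {B : Matrix G.edgeSet G.edgeSet ℤ}
    (hB : Bᵀ = -B) : ∃ y, skewOf ord y = B := by
  choose e f hne hU using fun U : EnhancedState G 2 ((Nat.card V : ℤ) - 2) => exists_eq_pairState U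
  have hskew : ∀ g h, B h g = - B g h := fun g h => congrFun (congrFun hB g) h
  refine ⟨fun U => edgeSign ord {e U} (f U) * B (e U) (f U), ?_⟩
  ext g h
  simp only [skewOf, Matrix.of_apply]
  split_ifs with hgh
  · -- the chosen ordered pair of edges of this state is `(g, h)` or `(h, g)`
    have h1 : ({g, h} : Finset G.edgeSet) = {e (pairState hgh), f (pairState hgh)} := by
      have := congrArg EnhancedState.edges (hU (pairState hgh))
      rw [Finset.pair_comm, Finset.pair_comm (e _)]
      exact this
    generalize e (pairState hgh) = e' at *
    generalize f (pairState hgh) = f' at *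
    have h2 : (e' = g ∧ f' = h) ∨ (e' = h ∧ f' = g) := by
      have h3 : g = e' ∨ g = f' := by
        have : g ∈ ({g, h} : Finset G.edgeSet) := by simp
        simpa [h1] using this
      have h4 : h = e' ∨ h = f' := by
        have : h ∈ ({g, h} : Finset G.edgeSet) := by simp
        simpa [h1] using this
      grind
    rcases h2 with ⟨rfl, rfl⟩ | ⟨rfl, rfl⟩
    · rw [← mul_assoc, edgeSign_mul_self, one_mul]
    · rw [edgeSign_singleton ord hgh, ← mul_assoc, neg_mul, edgeSign_mul_self, hskew]
      ring
  · rw [not_not] at hgh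
    subst hgh
    have := hskew g g
    omega

theorem boundary_eq_chainOf (ord : LinearOrder G.edgeSet)
    (y : ChainGroup G 2 ((Nat.card V : ℤ) - 2)) :
    boundary G ord 1 ((Nat.card V : ℤ) - 2) y =
      chainOf G (skewOf ord y * (edgeMatrix G)ᵀ) := by
  ext T
  obtain ⟨e, u, rfl⟩ := exists_eq_edgeState T
  change ∑ U, incidence G ord 1 ((Nat.card V : ℤ) - 2) (edgeState e u) U * y U = _
  rw [chainOf_edgeState]
  simp only [incidence_edgeState, Finset.sum_mul, Matrix.mul_apply, Matrix.transpose_apply]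
  have h1 : ∀ w, (if w = u ∨ w ∈ e.1 ∧ u ∈ e.1 then
        ∑ f, skewOf ord y e f * edgeMatrix G w f else 0) =
      ∑ f, skewOf ord y e f * if w = u ∨ w ∈ e.1 ∧ u ∈ e.1 then edgeMatrix G w f else 0 := by
    intro w
    split_ifs <;> simp
  refine Finset.sum_comm.trans
    (Eq.trans ?_ ((Finset.sum_congr rfl fun w _ => h1 w).trans Finset.sum_comm).symm)
  refine Finset.sum_congr rfl fun f _ => ?_
  rw [← Finset.mul_sum]
  by_cases hef : e ≠ f
  · simp only [dif_pos hef, ite_mul, zero_mul, Finset.sum_ite_eq, Finset.mem_univ, if_true,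
      skewOf, Matrix.of_apply]
    ring
  · simp [hef, skewOf]

theorem chainOf_mem_range_boundary_iff (ord : LinearOrder G.edgeSet)
    {Z : Matrix G.edgeSet V ℤ} :
    chainOf G Z ∈ LinearMap.range (boundary G ord 1 ((Nat.card V : ℤ) - 2)) ↔
      Z ∈ nullMatrices G ⊔ boundaryMatrices G := by
  constructor
  · rintro ⟨y, hy⟩
    rw [boundary_eq_chainOf] at hy
    have h1 := sub_eq_zero.2 hy.symm
    rw [← map_sub, chainOf_eq_zero_iff] at h1
    rw [← sub_add_cancel Z (skewOf ord y * (edgeMatrix G)ᵀ)]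
    exact add_mem (Submodule.mem_sup_left h1)
      (Submodule.mem_sup_right ⟨_, skewOf_transpose ord y, rfl⟩)
  · intro h
    obtain ⟨X, hX, _, ⟨B, hB, rfl⟩, rfl⟩ := Submodule.mem_sup.1 h
    obtain ⟨y, rfl⟩ := exists_skewOf_eq ord hB
    exact ⟨y, by rw [boundary_eq_chainOf, map_add, chainOf_eq_zero_iff.2 hX, zero_add]⟩

end Boundary

/-! ### The homology groups -/

section Assembly

variable {V : Type*} {G : SimpleGraph V} [Fintype V]

/-- The homology is the group of cycle matrices modulo the null and the boundary matrices. -/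
theorem nonempty_homology_addEquiv (ord : LinearOrder G.edgeSet) {T : Type*} [AddCommGroup T]
    (F : cycleMatrices G →+ T) (hF : Function.Surjective F)
    (hker : ∀ Z : cycleMatrices G, F Z = 0 ↔ Z.1 ∈ nullMatrices G ⊔ boundaryMatrices G) :
    Nonempty (Homology G ord 1 ((Nat.card V : ℤ) - 2) ≃+ T) := by
  let c : cycleMatrices G →ₗ[ℤ] cycles G ord 1 ((Nat.card V : ℤ) - 2) :=
    (chainOf G).restrict fun Z hZ => (chainOf_mem_cycles_iff ord).2 hZ
  let f : cycleMatrices G →+ Homology G ord 1 ((Nat.card V : ℤ) - 2) :=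
    ((Submodule.mkQ _).comp c).toAddMonoidHom
  have hf : Function.Surjective f := by
    refine (Submodule.mkQ_surjective _).comp ?_
    rintro ⟨z, hz⟩
    obtain ⟨Z, rfl⟩ := chainOf_surjective z
    exact ⟨⟨Z, (chainOf_mem_cycles_iff ord).1 hz⟩, rfl⟩
  have hfker : f.ker = F.ker := by
    ext Z
    rw [AddMonoidHom.mem_ker, AddMonoidHom.mem_ker, hker, ← chainOf_mem_range_boundary_iff ord]
    exact Submodule.Quotient.mk_eq_zero _
  exact ⟨(QuotientAddGroup.quotientKerEquivOfSurjective f hf).symm.trans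
    ((QuotientAddGroup.quotientAddEquivOfEq hfker).trans
      (QuotientAddGroup.quotientKerEquivOfSurjective F hF))⟩

theorem cyclomaticNumber_of_connected (hG : G.Connected) :
    cyclomaticNumber G = Fintype.card G.edgeSet + 1 - Fintype.card V := by
  have : Subsingleton G.ConnectedComponent := hG.preconnected.subsingleton_connectedComponent
  have : Nonempty G.ConnectedComponent := hG.nonempty.map G.connectedComponentMk
  rw [cyclomaticNumber, Nat.card_eq_fintype_card, Nat.card_eq_fintype_card (α := V),
    Nat.card_eq_one_iff_unique.2 ⟨inferInstance, inferInstance⟩]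

/-- A two-colouring of a connected graph, normalised to take the value `1` at `r`, gives the
coefficients of the vertices modulo the columns of the incidence matrix. -/
theorem exists_coloring_of_isBipartite (hG : G.Connected) (hb : G.IsBipartite) (r : V) :
    ∃ χ : V → ℤ, χ r = 1 ∧ (∀ a, χ a * χ a = 1) ∧ (∀ a b, G.Adj a b → χ a = - χ b) ∧
      ∀ a, ∃ q : G.edgeSet → ℤ, edgeMatrix G *ᵥ q = Pi.single a 1 - χ a • Pi.single r 1 := by
  obtain ⟨C⟩ := hb
  let χ : V → ℤ := fun a => if C a = C r then 1 else -1
  have hr : χ r = 1 := if_pos rfl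
  have hadj : ∀ a b, G.Adj a b → χ a = - χ b := by
    intro a b hab
    have := C.valid hab
    simp only [χ]
    generalize C a = x at *
    generalize C b = y at *
    generalize C r = z at *
    fin_cases x <;> fin_cases y <;> fin_cases z <;> simp_all
  refine ⟨χ, hr, fun a => ?_, hadj, fun a => ?_⟩
  · simp only [χ]; split_ifs <;> norm_num
  · obtain ⟨w⟩ := hG.preconnected a r
    have hw : ∀ {a b : V} (w : G.Walk a b), χ a = (-1) ^ w.length * χ b := by
      intro a b w
      induction w with
      | nil => simp
      | cons h w ih =>
        rw [hadj _ _ h, ih, SimpleGraph.Walk.length_cons, pow_succ]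
        ring
    obtain ⟨q, hq⟩ := exists_edgeMatrix_mulVec_of_walk w
    exact ⟨q, by rw [hq, hw w, hr, mul_one]⟩

theorem homology_of_isBipartite (ord : LinearOrder G.edgeSet) (hG : G.Connected)
    (hb : G.IsBipartite) :
    Nonempty (Homology G ord 1 ((Nat.card V : ℤ) - 2) ≃+ (Fin (cyclomaticNumber G) → ZMod 2)) := by
  obtain ⟨r⟩ := hG.nonempty
  obtain ⟨χ, hr, hχ1, hadj, hχ⟩ := exists_coloring_of_isBipartite hG hb r
  have hrank := finrank_ker_edgeMatrix_of_coloring hr hadj hχ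
  have hcyc : cyclomaticNumber G = Module.finrank ℤ (LinearMap.ker (edgeMatrix G).mulVecLin) := by
    rw [cyclomaticNumber_of_connected hG]
    omega
  obtain ⟨ψ, hψ, hψsurj⟩ := exists_mod_two_coordinates (edgeMatrix G).mulVecLin
  rw [hcyc]
  let F : cycleMatrices G →+ (Fin (Module.finrank ℤ (LinearMap.ker (edgeMatrix G).mulVecLin)) →
      ZMod 2) :=
    { toFun := fun Z => ψ (Z.1 *ᵥ 1)
      map_zero' := by simp
      map_add' := fun Z W => by simp [Matrix.add_mulVec] }
  refine nonempty_homology_addEquiv ord F (fun y => ?_) fun Z => ?_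
  · obtain ⟨k, hk, rfl⟩ := hψsurj y
    have hk : edgeMatrix G *ᵥ k = 0 := hk
    refine ⟨⟨_, mem_cycleMatrices_vecMulVec (r := r) fun a _ => congrFun hk a⟩, ?_⟩
    change ψ (vecMulVec k (Pi.single r 1) *ᵥ 1) = ψ k
    rw [Matrix.vecMulVec_mulVec]
    simp
  · rw [mem_sup_iff hG hχ (fun k hk => two_smul_mem_of_coloring hχ1 hadj hχ hk) ψ hψ Z.2]
    exact ⟨fun h => ⟨h, trace_eq_zero_of_coloring hχ1 hadj Z.2⟩, fun h => h.1⟩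

theorem homology_of_odd_cycle (ord : LinearOrder G.edgeSet) (hG : G.Connected) {r : V}
    (c : G.Walk r r) (hc : Odd c.length) :
    1 ≤ cyclomaticNumber G ∧
      Nonempty (Homology G ord 1 ((Nat.card V : ℤ) - 2) ≃+
        (Fin (cyclomaticNumber G - 1) → ZMod 2) × ℤ) := by
  obtain ⟨w, hw⟩ := exists_edgeMatrix_mulVec_of_walk c
  rw [hc.neg_one_pow, neg_smul, one_smul, sub_neg_eq_add, ← two_smul ℤ] at hw
  have hχ : ∀ a, ∃ q : G.edgeSet → ℤ, edgeMatrix G *ᵥ q =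
      Pi.single a 1 - (-1) ^ (hG.preconnected a r).some.length • Pi.single r 1 :=
    fun a => exists_edgeMatrix_mulVec_of_walk _
  have hrank := finrank_ker_edgeMatrix_of_eq_two hw hχ
  have hcyc : cyclomaticNumber G =
      Module.finrank ℤ (LinearMap.ker (edgeMatrix G).mulVecLin) + 1 := by
    rw [cyclomaticNumber_of_connected hG]
    omega
  refine ⟨by omega, ?_⟩
  rw [hcyc, Nat.add_sub_cancel]
  obtain ⟨ψ, hψ, hψsurj⟩ := exists_mod_two_coordinates (edgeMatrix G).mulVecLin
  let F : cycleMatrices G →+ (Fin (Module.finrank ℤ (LinearMap.ker (edgeMatrix G).mulVecLin)) →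
      ZMod 2) × ℤ :=
    { toFun := fun Z => (ψ (Z.1 *ᵥ 1), (edgeMatrix G * Z.1).trace / 2)
      map_zero' := by simp
      map_add' := fun Z W => by
        ext1
        · simp [Matrix.add_mulVec]
        · simp only [Submodule.coe_add, Matrix.mul_add, Matrix.trace_add, Prod.snd_add]
          exact Int.add_ediv_of_dvd_left (even_trace_of_mem_cycleMatrices Z.2).two_dvd }
  -- the value of `F` on `k ⊗ r`
  have hFk : ∀ (k : G.edgeSet → ℤ) (d : ℤ) (hk : edgeMatrix G *ᵥ k = d • Pi.single r 1),
      F ⟨vecMulVec k (Pi.single r 1), mem_cycleMatrices_vecMulVec fun a ha => by simp [hk, ha]⟩ =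
        (ψ k, d / 2) := by
    intro k d hk
    change (ψ (vecMulVec k (Pi.single r 1) *ᵥ 1),
      (edgeMatrix G * vecMulVec k (Pi.single r 1)).trace / 2) = _
    rw [Matrix.vecMulVec_mulVec, Matrix.mul_vecMulVec, Matrix.trace_vecMulVec, hk]
    simp
  refine nonempty_homology_addEquiv ord F ?_ fun Z => ?_
  · rintro ⟨y, d⟩
    obtain ⟨k, hk, hky⟩ := hψsurj (y - ψ (d • w))
    have hk : edgeMatrix G *ᵥ k = 0 := hk
    have h := hFk (k + d • w) (d * 2) (by
      rw [Matrix.mulVec_add, hk, zero_add, Matrix.mulVec_smul, hw, smul_smul])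
    rw [map_add, hky, sub_add_cancel, Int.mul_ediv_cancel _ two_ne_zero] at h
    exact ⟨_, h⟩
  · rw [mem_sup_iff hG hχ
      (fun k hk => Submodule.mem_sup_right (two_smul_mem_of_eq_two hw hk)) ψ hψ Z.2]
    change (_, _) = (0, 0) ↔ _
    rw [Prod.mk.injEq]
    have := even_trace_of_mem_cycleMatrices Z.2
    refine and_congr_right fun _ => ⟨fun h => ?_, fun h => by rw [h]; rfl⟩
    obtain ⟨t, ht⟩ := this
    omega

end Assembly

end ChromaticHomology

/-- The graph `G` is finite, simple and connected, and its edges carry an arbitrary ordering, from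
which the signs in the chromatic complex are formed. -/
theorem mainTheorem2 {V : Type*} [Finite V] (G : SimpleGraph V) (ord : LinearOrder G.edgeSet)
    (hG : G.Connected) :
    (G.IsBipartite →
      Nonempty (ChromaticHomology.Homology G ord 1 ((Nat.card V : ℤ) - 2) ≃+
        (Fin (ChromaticHomology.cyclomaticNumber G) → ZMod 2))) ∧
    ((∃ (v : V) (w : G.Walk v v), w.IsCycle ∧ Odd w.length) →
      1 ≤ ChromaticHomology.cyclomaticNumber G ∧
      Nonempty (ChromaticHomology.Homology G ord 1 ((Nat.card V : ℤ) - 2) ≃+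
        (Fin (ChromaticHomology.cyclomaticNumber G - 1) → ZMod 2) × ℤ)) := by
  have : Fintype V := Fintype.ofFinite V
  exact ⟨ChromaticHomology.homology_of_isBipartite ord hG, fun ⟨_, c, _, hc⟩ =>
    ChromaticHomology.homology_of_odd_cycle ord hG c hc⟩
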